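/- **Setting.** There are $K$ arms $A=\{a_1,\dots,a_K\}$ with mutually independent static rewards $X(a_1),\dots,X(a_K)$ (each is realized once and then stays fixed), with known distributions and with means $\mu(a_i)=\mathbb E[X(a_i)]\neq 0$, and a safe arm $a_0$ whose reward is always $0$. In each of $T$ rounds the decision maker picks a portfolio $p$, i.e. a probability distribution on $A^+=A\cup\{a_0\}$, depending on the arms and rewards realized so far; an arm is drawn from $p$ and its reward is observed. With $\mathcal I_t$ the information before round $t$, the round's reward is $r^t=\sum_{a\in A^+}p^t(a)\,\mathbb E[X(a)\mid\mathcal I_t]$. An algorithm is safe if $\sum_{a\in A}p^t(a)\,\mathbb E[X(a)\mid\mathcal I_t]\ge 0$ in every round. Let $\mathcal U_T(\mathsf{ALG})=\mathbb E\big[\sum_{t=1}^T r^t\big]$ and let $\mathsf{OPT}_T$ be the supremum of $\mathcal U_T$ over all safe algorithms (which may depend on $T$). For a set $s\subseteq A$ of unexplored arms let $\mathrm{above}(s)=\{a\in s:\mu(a)>0\}$ and $\mathrm{below}(s)=\{a\in s:\mu(a)<0\}$; call $s$ terminal if no probability distribution $p$ on $s$ satisfies $\sum_{a\in s}p(a)\mu(a)\ge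 0$. **The algorithm $\mathsf{SEGB}'$.** As long as the set $s$ of unexplored arms is not terminal and the reward $x^+$ has not been realized, let $a_i$ be an arm of largest mean in $\mathrm{above}(s)$. If $\mathrm{below}(s)=\emptyset$, play $a_i$. Otherwise let $a_j$ be an arm of largest mean in $\mathrm{below}(s)$, and play $a_i$ with probability $\frac{-\mu(a_j)}{\mu(a_i)-\mu(a_j)}$ and $a_j$ with probability $\frac{\mu(a_i)}{\mu(a_i)-\mu(a_j)}$. As soon as $x^+$ has been realized or $s$ is terminal, play forever an arm with the highest reward among the explored arms and $a_0$. All ties are broken arbitrarily. **Proposition.** Let $x^-\le x^+$ be real numbers such that $X(a_i)\in\{x^-,x^+\}$ almost surely for every $i$. If $\mathrm{above}(A)$ and $\mathrm{below}(A)$ are both nonempty, assume moreover that $0<\Pr(X(a_i)=x^+)<1$ for every $i$. Then algorithms $\mathsf{SEGB}'$ exist, and there is $T_0$, depending only on the instance, such that for all $T\ge T_0$ and however ties are broken, $\mathsf{SEGB}'$ is safe, the utilities $\mathcal U_T$ of safe algorithms are bounded above, and $$\mathcal U_T(\mathsf{SEGB}')=\mathsf{OPT}_T .$$ -/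

import Mathlib

open MeasureTheory ProbabilityTheory

noncomputable section

namespace SafeBandit

/-- The arms `A⁺`: the arm `some i` for `i : Fin K`, and the safe arm `a₀ = none`. -/
abbrev Arm (K : ℕ) : Type := Option (Fin K)

/-- A portfolio is a probability distribution over `A⁺`. -/
abbrev Portfolio (K : ℕ) : Type := stdSimplex ℝ (Arm K)

/-- The arms that were realized in the previous rounds with their rewards, in order. -/
abbrev History (K : ℕ) : Type := List (Arm K × ℝ)

/-- An algorithm picks a portfolio in every round, given everything it has observed. -/
abbrev Algorithm (K : ℕ) : Type := History K → Portfolio K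

variable {Ω : Type*} [MeasurableSpace Ω] {K : ℕ}

/-- The rewards of the arms of `A⁺`; the safe arm has reward `0`. -/
def reward (X : Fin K → Ω → ℝ) : Arm K → Ω → ℝ
  | none => fun _ => 0
  | some i => X i

/-- The expected reward `μ(aᵢ)` according to the prior. -/
def mean (P : Measure Ω) (X : Fin K → Ω → ℝ) (i : Fin K) : ℝ := ∫ ω, X i ω ∂P

/-- The event that the static rewards agree with all the rewards observed in `h`. -/
def agree (X : Fin K → Ω → ℝ) (h : History K) : Set Ω :=
  {ω | ∀ e ∈ h, reward X e.1 ω = e.2}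

/-- `E[X(a) ∣ I]`, where `I` is the information carried by the history `h`. Rewards are discrete
in what follows, so this is conditioning on the event of the observed rewards; if that event is
null, then `h` almost surely does not occur (and the value is `0`). -/
def posteriorMean (P : Measure Ω) (X : Fin K → Ω → ℝ) (h : History K) (a : Arm K) : ℝ :=
  ∫ ω, reward X a ω ∂(P[|agree X h])

/-- The reward `rᵗ` of a round in which portfolio `p` is played after the history `h`. -/
def roundReward (P : Measure Ω) (X : Fin K → Ω → ℝ) (h : History K) (p : Portfolio K) : ℝ :=
  ∑ a, p.1 a * posteriorMean P X h a

/-- A portfolio is Bayesian-safe with respect to the information carried by `h`. -/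
def IsSafePortfolio (P : Measure Ω) (X : Fin K → Ω → ℝ) (h : History K) (p : Portfolio K) :
    Prop :=
  0 ≤ ∑ i, p.1 (some i) * posteriorMean P X h (some i)

/-- The algorithm picks safe portfolios only. -/
def IsSafe (P : Measure Ω) (X : Fin K → Ω → ℝ) (alg : Algorithm K) : Prop :=
  ∀ h, IsSafePortfolio P X h (alg h)

/-- The expectation over the coin flips of the sum of `rᵗ` over the next `n` rounds, from
history `h` on, when the rewards of the arms are `x`. -/
def runUtility (P : Measure Ω) (X : Fin K → Ω → ℝ) (alg : Algorithm K) (x : Arm K → ℝ) :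
    ℕ → History K → ℝ
  | 0, _ => 0
  | n + 1, h => roundReward P X h (alg h) +
      ∑ a, (alg h).1 a * runUtility P X alg x n (h ++ [(a, x a)])

/-- The utility `U_T(ALG) = E[∑_{t ≤ T} rᵗ]`, the expectation being over the rewards and the
coin flips. -/
def utility (P : Measure Ω) (X : Fin K → Ω → ℝ) (T : ℕ) (alg : Algorithm K) : ℝ :=
  ∫ ω, runUtility P X alg (fun a => reward X a ω) T [] ∂P

/-- The utilities over `T` rounds that safe algorithms achieve. -/
def safeUtilities (P : Measure Ω) (X : Fin K → Ω → ℝ) (T : ℕ) : Set ℝ :=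
  {u | ∃ alg : Algorithm K, IsSafe P X alg ∧ utility P X T alg = u}

/-- `OPT_T`, the highest possible utility of a safe algorithm. -/
def opt (P : Measure Ω) (X : Fin K → Ω → ℝ) (T : ℕ) : ℝ := sSup (safeUtilities P X T)

open Classical in
/-- `above(s)`: the arms of `s` with positive mean. -/
def above (μ : Fin K → ℝ) (s : Finset (Fin K)) : Finset (Fin K) := s.filter fun i => 0 < μ i

open Classical in
/-- `below(s)`: the arms of `s` with negative mean. -/
def below (μ : Fin K → ℝ) (s : Finset (Fin K)) : Finset (Fin K) := s.filter fun i => μ i < 0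

/-- `safe(s)`: the distributions over `s` whose prior expected reward is nonnegative. -/
def safe (μ : Fin K → ℝ) (s : Finset (Fin K)) : Set (Fin K → ℝ) :=
  {p | p ∈ stdSimplex ℝ (Fin K) ∧ (∀ i, i ∉ s → p i = 0) ∧ 0 ≤ ∑ i ∈ s, p i * μ i}

/-- The set `s` of unexplored arms is a terminal state. -/
def IsTerminal (μ : Fin K → ℝ) (s : Finset (Fin K)) : Prop := safe μ s = ∅

/-- The portfolio that puts all its weight on one arm. -/
def single (a : Arm K) : Arm K → ℝ := fun b => if b = a then 1 else 0

/-- The portfolio `p_{i,j}`, for `aᵢ` with positive mean and `aⱼ` with negative mean. -/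
def pair (μ : Fin K → ℝ) (i j : Fin K) : Arm K → ℝ := fun b =>
  if b = some i then -μ j / (μ i - μ j)
  else if b = some j then μ i / (μ i - μ j)
  else 0

/-- `p` is a portfolio that `OGP` may play in the nonterminal state `s` when the arms of `above(s)`
are taken in decreasing order: `p_{i,i}` if `below(s) = ∅` and `p_{i,j}` otherwise, where `aᵢ` is
a best arm of `above(s)` and `aⱼ` is a best arm of `below(s)`. -/
def IsOGPChoice (μ : Fin K → ℝ) (s : Finset (Fin K)) (p : Arm K → ℝ) : Prop :=
  ∃ i ∈ above μ s, (∀ i' ∈ above μ s, μ i' ≤ μ i) ∧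
    ((below μ s = ∅ ∧ p = single (some i)) ∨
      ∃ j ∈ below μ s, (∀ j' ∈ below μ s, μ j' ≤ μ j) ∧ p = pair μ i j)

open Classical in
/-- The arms of `A` that were not realized in `h`. -/
def unexplored (h : History K) : Finset (Fin K) :=
  Finset.univ.filter fun i => ∀ r, (some i, r) ∉ h

/-- `p` plays with probability one an arm with the highest reward among the explored arms and
the safe arm. -/
def IsExploit (h : History K) (p : Arm K → ℝ) : Prop :=
  ∃ e ∈ ((none, 0) :: h : History K),
    (∀ e' ∈ ((none, 0) :: h : History K), e'.2 ≤ e.2) ∧ p = single e.1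

/-- `alg` is the algorithm `SEGB'` (for some way of breaking ties): it plays `OGP` on the set of
unexplored arms until this set is terminal or a reward `xp` is realized, and exploits from then
on. -/
structure IsSEGB' (μ : Fin K → ℝ) (xp : ℝ) (alg : Algorithm K) : Prop where
  explore : ∀ h : History K, (∀ i, (some i, xp) ∉ h) → ¬ IsTerminal μ (unexplored h) →
    IsOGPChoice μ (unexplored h) (alg h).1
  exploit : ∀ h : History K, ((∃ i, (some i, xp) ∈ h) ∨ IsTerminal μ (unexplored h)) →
    IsExploit h (alg h).1

end SafeBandit

end

/-! Until `xp` is found, only the set of unexplored arms and the number of remaining rounds matter,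
so the problem is a dynamic program. Let `r i` be the probability that arm `i` misses `xp`, and
measure utility by its shortfall from `n * xp` in units of `xp - xm`. Exploring `i` then costs `r i
* (1 + W)`, where `W` is the cost of the state left after a failure. With `c = xp / (xp - xm)` the
mean of `i` is `(xp - xm) * (c - r i)`. Arms thus become points in the plane, with abscissa `r i`
and the exploration cost as ordinate, and a pair of mean zero costs the height of its chord over
`c`.

When both signs occur, two facts carry the proof. The first is that the greedy pair attains the
lowest chord (`chord_best_le`, `loss_eq_chord`), by exchanging the order of two explorations. The
second is Lagrangian duality: the line through the two greedy points lies below all other points,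
and if it does not ascend, minus its slope is a price that turns the safety constraint into a bound
on every portfolio (`exists_price`, `TwoValued.value_succ_le`). The sign of the price is right once
enough rounds remain, because the loss exceeds the cost of the best arm of negative mean by a
linearly growing amount (`exists_linear_gap`). With few rounds left the price may be unavailable;
`exists_value_le` carries an error term for this. To profit from it an algorithm would have to wait,
and each round of waiting costs at least `(1 - c) * xp` (`loss_add_two_sub_le_sq`), so the error
vanishes for long horizons. This produces the threshold on the horizon. `le_value` shows that the
algorithm attains the bound.

If all means are positive, the price is zero and the greedy order is optimal for every horizon
(`loss_eq_single`). If all are negative, every safe algorithm earns zero. -/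

noncomputable section

namespace SafeBandit

/-! ### The loss recursion and the order of single explorations. -/

section Loss

variable {ι : Type*} [DecidableEq ι] {c L : ℝ} {r : ι → ℝ}

/-- The chord through `(a, a * (1 + u))` and `(b, b * (1 + v))`, evaluated at `c`. -/
def chord (c a b u v : ℝ) : ℝ :=
  ((b - c) * (a * (1 + u)) + (c - a) * (b * (1 + v))) / (b - a)

/-- The normalized loss over `n` rounds, compared to knowing an arm with the high reward, of the
best exploration by single arms of `I` or, while `J` is nonempty, pairs from `I × J`. The
probability of the low reward is `r i` for arm `i`. -/
def loss (c L : ℝ) (r : ι → ℝ) : ℕ → Finset ι → Finset ι → ℝ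
  | 0, _, _ => 0
  | n + 1, I, J =>
    if hI : I.Nonempty then
      if hJ : J.Nonempty then
        (I ×ˢ J).inf' (hI.product hJ) fun e =>
          chord c (r e.1) (r e.2) (loss c L r n (I.erase e.1) J) (loss c L r n I (J.erase e.2))
      else I.inf' hI fun i => r i * (1 + loss c L r n (I.erase i) J)
    else L * (n + 1)

@[simp] lemma loss_zero (I J : Finset ι) : loss c L r 0 I J = 0 := rfl

lemma loss_empty (n : ℕ) (J : Finset ι) : loss c L r n ∅ J = L * n := by
  cases n <;> simp [loss]

lemma loss_le_single (n : ℕ) {I : Finset ι} {i : ι} (hi : i ∈ I) :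
    loss c L r (n + 1) I ∅ ≤ r i * (1 + loss c L r n (I.erase i) ∅) := by
  rw [loss, dif_pos ⟨i, hi⟩, dif_neg (by simp)]
  exact Finset.inf'_le (fun i => r i * (1 + loss c L r n (I.erase i) ∅)) hi

lemma exists_loss_eq_single (n : ℕ) {I : Finset ι} (hI : I.Nonempty) :
    ∃ i ∈ I, loss c L r (n + 1) I ∅ = r i * (1 + loss c L r n (I.erase i) ∅) := by
  rw [loss, dif_pos hI, dif_neg (by simp)]
  exact Finset.exists_mem_eq_inf' hI _

lemma loss_le_chord (n : ℕ) {I J : Finset ι} {i j : ι} (hi : i ∈ I) (hj : j ∈ J) :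
    loss c L r (n + 1) I J ≤
      chord c (r i) (r j) (loss c L r n (I.erase i) J) (loss c L r n I (J.erase j)) := by
  rw [loss, dif_pos ⟨i, hi⟩, dif_pos ⟨j, hj⟩]
  exact Finset.inf'_le (fun e : ι × ι => chord c (r e.1) (r e.2)
    (loss c L r n (I.erase e.1) J) (loss c L r n I (J.erase e.2))) (Finset.mk_mem_product hi hj)

lemma exists_loss_eq_chord (n : ℕ) {I J : Finset ι} (hI : I.Nonempty) (hJ : J.Nonempty) :
    ∃ i ∈ I, ∃ j ∈ J, loss c L r (n + 1) I J =
      chord c (r i) (r j) (loss c L r n (I.erase i) J) (loss c L r n I (J.erase j)) := by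
  rw [loss, dif_pos hI, dif_pos hJ]
  obtain ⟨e, he, h⟩ := Finset.exists_mem_eq_inf' (hI.product hJ) fun e : ι × ι =>
    chord c (r e.1) (r e.2) (loss c L r n (I.erase e.1) J) (loss c L r n I (J.erase e.2))
  exact ⟨e.1, (Finset.mem_product.1 he).1, e.2, (Finset.mem_product.1 he).2, h⟩

/-- Exploring single arms, a best arm first is optimal. -/
lemma loss_eq_single (hr0 : ∀ i, 0 ≤ r i) (n : ℕ) : ∀ {I : Finset ι} {i : ι}, i ∈ I →
    (∀ k ∈ I, r i ≤ r k) → loss c L r (n + 1) I ∅ = r i * (1 + loss c L r n (I.erase i) ∅) := by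
  induction n with
  | zero =>
    intro I i hi hmin
    refine le_antisymm (loss_le_single 0 hi) ?_
    obtain ⟨k, hk, h⟩ := exists_loss_eq_single (c := c) (L := L) (r := r) 0 ⟨i, hi⟩
    rw [h]
    simpa using hmin k hk
  | succ n ih =>
    intro I i hi hmin
    refine le_antisymm (loss_le_single _ hi) ?_
    obtain ⟨k, hk, h⟩ := exists_loss_eq_single (c := c) (L := L) (r := r) (n + 1) ⟨i, hi⟩
    rw [h]
    rcases eq_or_ne k i with rfl | hki
    · exact le_rfl
    -- Exchange: trying `k` and then `i` costs `r k - r i` more than `i` and then `k`, since both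
    -- orders lead to the same state after two failures.
    · have h1 := ih (I := I.erase k) (Finset.mem_erase.2 ⟨hki.symm, hi⟩)
        fun l hl => hmin l (Finset.mem_of_mem_erase hl)
      have h2 := loss_le_single (c := c) (L := L) (r := r) n
        (I := I.erase i) (Finset.mem_erase.2 ⟨hki, hk⟩)
      rw [Finset.erase_right_comm] at h2
      rw [h1]
      nlinarith [mul_le_mul_of_nonneg_left h2 (hr0 i), hmin k hk]

/-- If arm `i` is safe, then waiting does not help. -/
lemma loss_single_succ_sub_le (hr0 : ∀ i, 0 ≤ r i) (hr1 : ∀ i, r i ≤ 1) (hL : 0 ≤ L) (n : ℕ) :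
    ∀ {I : Finset ι}, (∀ i ∈ I, r i ≤ L) →
    loss c L r (n + 1) I ∅ - loss c L r n I ∅ ≤ L := by
  induction n with
  | zero =>
    intro I hI
    rcases I.eq_empty_or_nonempty with rfl | ⟨i, hi⟩
    · simp [loss_empty]
    · have := loss_le_single (c := c) (L := L) (r := r) 0 hi
      simp at this
      simpa using this.trans (hI i hi)
  | succ n ih =>
    intro I hI
    rcases I.eq_empty_or_nonempty with rfl | hne
    · simp only [loss_empty]; push_cast; linarith
    · obtain ⟨i, hi, h⟩ := exists_loss_eq_single (c := c) (L := L) (r := r) n hne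
      have h1 := loss_le_single (c := c) (L := L) (r := r) (n + 1) hi
      have h2 := ih (I := I.erase i) fun k hk => hI k (Finset.mem_of_mem_erase hk)
      nlinarith [hr0 i, hr1 i]

/-! ### Exchange arguments for pairs of arms. -/

/-- The arms of `I` have a positive mean, those of `J` a negative one. -/
structure Separated (c : ℝ) (r : ι → ℝ) (I J : Finset ι) : Prop where
  left : ∀ i ∈ I, r i < c
  right : ∀ j ∈ J, c < r j

lemma Separated.erase_left {I J : Finset ι} (h : Separated c r I J) (i : ι) :
    Separated c r (I.erase i) J :=
  ⟨fun k hk => h.left k (Finset.mem_of_mem_erase hk), h.right⟩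

lemma Separated.erase_right {I J : Finset ι} (h : Separated c r I J) (j : ι) :
    Separated c r I (J.erase j) :=
  ⟨h.left, fun k hk => h.right k (Finset.mem_of_mem_erase hk)⟩

lemma chord_spec {a b : ℝ} (h : a < b) (u v : ℝ) :
    (b - a) * chord c a b u v = (b - c) * (a * (1 + u)) + (c - a) * (b * (1 + v)) := by
  rw [chord, mul_div_cancel₀]
  exact (sub_pos.2 h).ne'

/-- `i` and `j` are best arms of `I` and `J`. -/
structure Best (r : ι → ℝ) (I J : Finset ι) (i j : ι) : Prop where
  memL : i ∈ I
  memR : j ∈ J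
  leL : ∀ k ∈ I, r i ≤ r k
  leR : ∀ k ∈ J, r j ≤ r k

/-- If the chord is optimal for all pairs with one best arm, it is optimal. -/
lemma loss_eq_chord_of_le {n : ℕ} {I J : Finset ι} {i j : ι} (hs : Separated c r I J)
    (hi : i ∈ I) (hj : j ∈ J)
    (hL : ∀ k ∈ I,
      chord c (r i) (r j) (loss c L r n (I.erase i) J) (loss c L r n I (J.erase j)) ≤
      chord c (r k) (r j) (loss c L r n (I.erase k) J) (loss c L r n I (J.erase j)))
    (hR : ∀ k ∈ J,
      chord c (r i) (r j) (loss c L r n (I.erase i) J) (loss c L r n I (J.erase j)) ≤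
      chord c (r i) (r k) (loss c L r n (I.erase i) J) (loss c L r n I (J.erase k))) :
    loss c L r (n + 1) I J =
      chord c (r i) (r j) (loss c L r n (I.erase i) J) (loss c L r n I (J.erase j)) := by
  refine le_antisymm (loss_le_chord n hi hj) ?_
  obtain ⟨k, hk, l, hl, h⟩ := exists_loss_eq_chord (c := c) (L := L) (r := r) n ⟨i, hi⟩ ⟨j, hj⟩
  rw [h]
  have ai := hs.left i hi
  have ak := hs.left k hk
  have bj := hs.right j hj
  have bl := hs.right l hl
  have e0 := chord_spec (c := c) (ai.trans bj) (loss c L r n (I.erase i) J)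
    (loss c L r n I (J.erase j))
  have e1 := chord_spec (c := c) (ak.trans bj) (loss c L r n (I.erase k) J)
    (loss c L r n I (J.erase j))
  have e2 := chord_spec (c := c) (ai.trans bl) (loss c L r n (I.erase i) J)
    (loss c L r n I (J.erase l))
  have e3 := chord_spec (c := c) (ak.trans bl) (loss c L r n (I.erase k) J)
    (loss c L r n I (J.erase l))
  have l1 := hL k hk
  have l2 := hR l hl
  set Z := chord c (r i) (r j) (loss c L r n (I.erase i) J) (loss c L r n I (J.erase j))
  generalize chord c (r k) (r j) _ _ = Z1 at *
  generalize chord c (r i) (r l) _ _ = Z2 at *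
  generalize chord c (r k) (r l) _ _ = Z3 at *
  generalize r i * (1 + _) = yi at *
  generalize r j * (1 + _) = yj at *
  generalize r k * (1 + _) = yk at *
  generalize r l * (1 + _) = yl at *
  have d1 : 0 ≤ (r j - r k) * (Z1 - Z) :=
    mul_nonneg (by linarith) (by linarith)
  have d2 : 0 ≤ (r l - r i) * (Z2 - Z) :=
    mul_nonneg (by linarith) (by linarith)
  -- with slope `s`, `yk ≥ Z + s * (c - r k)` and `yl ≥ Z + s * (c - r l)`
  have f1 : (r j - c) * (yk - Z) ≥ (c - r k) * (Z - yj) := by nlinarith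
  have f2 : (c - r i) * (yl - Z) ≥ (r l - c) * (Z - yi) := by nlinarith
  have f0 : (r j - c) * (yi - Z) = (c - r i) * (Z - yj) := by nlinarith
  have hpos : 0 < (r j - c) * (c - r i) * (r l - r k) := by
    apply mul_pos (mul_pos _ _) <;> linarith
  have g1 : (r l - c) * (c - r i) * ((r j - c) * (yk - Z)) ≥
      (r l - c) * (c - r i) * ((c - r k) * (Z - yj)) :=
    mul_le_mul_of_nonneg_left f1 (mul_nonneg (by linarith) (by linarith))
  have g2 : (c - r k) * (r j - c) * ((c - r i) * (yl - Z)) ≥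
      (c - r k) * (r j - c) * ((r l - c) * (Z - yi)) :=
    mul_le_mul_of_nonneg_left f2 (mul_nonneg (by linarith) (by linarith))
  have g0 : (r l - c) * (c - r k) * ((r j - c) * (yi - Z)) =
      (r l - c) * (c - r k) * ((c - r i) * (Z - yj)) := by rw [f0]
  have key : 0 ≤ (r j - c) * (c - r i) * (r l - r k) * (Z3 - Z) := by
    have : (r j - c) * (c - r i) * (r l - r k) * (Z3 - Z) =
      (r j - c) * (c - r i) * ((r l - c) * (yk - Z) + (c - r k) * (yl - Z)) := by
      linear_combination (r j - c) * (c - r i) * e3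
    rw [this]
    nlinarith
  have := nonneg_of_mul_nonneg_right key hpos
  linarith

/-- Expand both continuations by one more round, using `a'` after `a` failed and `a` after `a'`
failed. The state `R` in which both failed contributes equally and cancels. What remains is `hQ`:
for `a < a'`, the line through the points of `a` and `a'`, in the state where `b` failed, has height
at least `V` at `c`. -/
lemma chord_le_chord_left {a a' b R u u' v v' V : ℝ} (ha : a ≤ a') (ha' : a' < c) (hb : c < b)
    (ha0 : 0 ≤ a) (hb0 : 0 ≤ b)
    (hu' : u' = chord c a b R v') (hu : u ≤ chord c a' b R v)
    (hQ : (a' - a) * V ≤ (c - a) * (a' * (1 + v')) - (c - a') * (a * (1 + v))) :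
    chord c a b u V ≤ chord c a' b u' V := by
  have e1 := chord_spec (c := c) (by linarith : a < b) R v'
  have e2 := chord_spec (c := c) (by linarith : a' < b) R v
  have e3 := chord_spec (c := c) (by linarith : a < b) u V
  have e4 := chord_spec (c := c) (by linarith : a' < b) u' V
  rw [← hu'] at e1
  have h2 : (b - a') * u ≤ (b - a') * chord c a' b R v :=
    mul_le_mul_of_nonneg_left hu (by linarith)
  rw [e2] at h2
  have h3 := mul_le_mul_of_nonneg_left h2 (mul_nonneg (sub_nonneg.2 hb.le) ha0)
  have h4 := mul_le_mul_of_nonneg_left hQ (mul_nonneg (sub_nonneg.2 hb.le) hb0)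
  have key : 0 ≤ (b - a) * (b - a') * (chord c a' b u' V - chord c a b u V) := by
    have : (b - a) * (b - a') * (chord c a' b u' V - chord c a b u V) =
        (b - a) * ((b - c) * (a' * (1 + u')) + (c - a') * (b * (1 + V))) -
        (b - a') * ((b - c) * (a * (1 + u)) + (c - a) * (b * (1 + V))) := by
      linear_combination (b - a) * e4 - (b - a') * e3
    rw [this]
    have e1' : (b - c) * a' * ((b - a) * u') =
      (b - c) * a' * ((b - c) * (a * (1 + R)) + (c - a) * (b * (1 + v'))) := by rw [e1]
    linarith
  have := nonneg_of_mul_nonneg_right key (mul_pos (by linarith) (by linarith))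
  linarith

/-- The mirror image: the state `Y` in which `b` and `d` both failed cancels. What remains is `hK`:
for `b < d`, the line through the points of `b` and `d`, in the state where `a` failed, has height
at most `u` at `c`. -/
lemma chord_le_chord_right {a b d u Vb Vd ub ud Y : ℝ} (ha : a < c) (hb : c < b) (hd : b ≤ d)
    (ha0 : 0 ≤ a) (hb0 : 0 ≤ b)
    (hVd : Vd = chord c a b ud Y) (hVb : Vb ≤ chord c a d ub Y)
    (hK : 0 ≤ (d - b) * u + (b - c) * (d * (1 + ud)) - (d - c) * (b * (1 + ub))) :
    chord c a b u Vb ≤ chord c a d u Vd := by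
  have e1 := chord_spec (c := c) (by linarith : a < b) ud Y
  have e2 := chord_spec (c := c) (by linarith : a < d) ub Y
  have e3 := chord_spec (c := c) (by linarith : a < b) u Vb
  have e4 := chord_spec (c := c) (by linarith : a < d) u Vd
  rw [← hVd] at e1
  have h2 : (d - a) * Vb ≤ (d - a) * chord c a d ub Y :=
    mul_le_mul_of_nonneg_left hVb (by linarith)
  rw [e2] at h2
  have h3 := mul_le_mul_of_nonneg_left h2 (mul_nonneg (sub_nonneg.2 ha.le) hb0)
  have h4 := mul_nonneg (mul_nonneg (sub_nonneg.2 ha.le) ha0) hK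
  have key : 0 ≤ (b - a) * (d - a) * (chord c a d u Vd - chord c a b u Vb) := by
    have : (b - a) * (d - a) * (chord c a d u Vd - chord c a b u Vb) =
        (b - a) * ((d - c) * (a * (1 + u)) + (c - a) * (d * (1 + Vd))) -
        (d - a) * ((b - c) * (a * (1 + u)) + (c - a) * (b * (1 + Vb))) := by
      linear_combination (b - a) * e4 - (d - a) * e3
    rw [this]
    have e1' : (c - a) * d * ((b - a) * Vd) =
      (c - a) * d * ((b - c) * (a * (1 + ud)) + (c - a) * (b * (1 + Y))) := by rw [e1]
    linarith
  have := nonneg_of_mul_nonneg_right key (mul_pos (by linarith) (by linarith))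
  linarith

/-- Consequence of the optimality of best pairs for the arms of `I`, valid also if `J = ∅`. -/
lemma mul_loss_le (hr0 : ∀ i, 0 ≤ r i) {n : ℕ} {I J : Finset ι} {i k : ι}
    (hs : Separated c r I J) (hi : i ∈ I) (hmin : ∀ l ∈ I, r i ≤ r l) (hk : k ∈ I)
    (hopt : ∀ j, Best r I J i j → ∀ l ∈ I,
      chord c (r i) (r j) (loss c L r n (I.erase i) J) (loss c L r n I (J.erase j)) ≤
      chord c (r l) (r j) (loss c L r n (I.erase l) J) (loss c L r n I (J.erase j)))
    (heq : ∀ j, Best r I J i j → loss c L r (n + 1) I J =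
      chord c (r i) (r j) (loss c L r n (I.erase i) J) (loss c L r n I (J.erase j))) :
    (r k - r i) * loss c L r (n + 1) I J ≤
      (c - r i) * (r k * (1 + loss c L r n (I.erase k) J)) -
      (c - r k) * (r i * (1 + loss c L r n (I.erase i) J)) := by
  have hik := hmin k hk
  have hkc := hs.left k hk
  rcases J.eq_empty_or_nonempty with rfl | hJ
  · have h1 := loss_le_single (c := c) (L := L) (r := r) n hk
    have h2 := loss_eq_single (c := c) (L := L) (r := r) hr0 n hi hmin
    rw [← h2]
    nlinarith
  · obtain ⟨j, hj, hjmin⟩ := J.exists_min_image r hJ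
    have hB : Best r I J i j := ⟨hi, hj, hmin, hjmin⟩
    have h1 := hopt j hB k hk
    have h2 := heq j hB
    rw [← h2] at h1
    have hjc := hs.right j hj
    have e1 := chord_spec (c := c) (by linarith : r i < r j) (loss c L r n (I.erase i) J)
      (loss c L r n I (J.erase j))
    have e2 := chord_spec (c := c) (by linarith : r k < r j) (loss c L r n (I.erase k) J)
      (loss c L r n I (J.erase j))
    rw [← h2] at e1
    have h3 : (r j - r k) * loss c L r (n + 1) I J ≤ _ :=
      mul_le_mul_of_nonneg_left h1 (by linarith)
    rw [e2] at h3
    generalize r k * (1 + _) = yk at *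
    generalize r i * (1 + _) = yi at *
    generalize r j * (1 + _) = yj at *
    generalize loss c L r (n + 1) I J = Z at *
    -- Eliminating `yj`: the point of `k` lies on or above the line from `i` to `j`, so extending
    -- the line from `i` through `k` to `c` gives at least `Z`.
    have h4 := mul_le_mul_of_nonneg_left h3 (by linarith : 0 ≤ c - r i)
    have e4 : (c - r k) * ((r j - r i) * Z) = (c - r k) * ((r j - c) * yi + (c - r i) * yj) := by
      rw [e1]
    refine le_of_mul_le_mul_left ?_ (by linarith : 0 < r j - c)
    linarith

/-- Best pairs minimize the loss. -/
lemma chord_best_le (hr0 : ∀ i, 0 ≤ r i) (hc0 : 0 ≤ c) (hc1 : c ≤ 1) (n : ℕ) :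
    ∀ {I J : Finset ι} {i j : ι}, Separated c r I J → Best r I J i j →
    (∀ k ∈ I,
      chord c (r i) (r j) (loss c c r n (I.erase i) J) (loss c c r n I (J.erase j)) ≤
      chord c (r k) (r j) (loss c c r n (I.erase k) J) (loss c c r n I (J.erase j))) ∧
    (∀ k ∈ J,
      chord c (r i) (r j) (loss c c r n (I.erase i) J) (loss c c r n I (J.erase j)) ≤
      chord c (r i) (r k) (loss c c r n (I.erase i) J) (loss c c r n I (J.erase k))) := by
  induction n with
  | zero =>
    intro I J i j hs hB
    -- In the last round all points lie on the diagonal, so all pairs tie.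
    have hconst : ∀ k ∈ I, ∀ l ∈ J, chord c (r k) (r l) 0 0 = c := by
      intro k hk l hl
      have hkc := hs.left k hk
      have hlc := hs.right l hl
      rw [chord, div_eq_iff (by linarith)]
      ring
    simp only [loss_zero]
    refine ⟨fun k hk => ?_, fun k hk => ?_⟩
    · rw [hconst i hB.memL j hB.memR, hconst k hk j hB.memR]
    · rw [hconst i hB.memL j hB.memR, hconst i hB.memL k hk]
  | succ n ih =>
    have heq : ∀ {I J : Finset ι} {i j : ι}, Separated c r I J → Best r I J i j →
        loss c c r (n + 1) I J =
        chord c (r i) (r j) (loss c c r n (I.erase i) J) (loss c c r n I (J.erase j)) :=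
      fun hs hB => loss_eq_chord_of_le hs hB.memL hB.memR (ih hs hB).1 (ih hs hB).2
    intro I J i j hs hB
    have hic := hs.left i hB.memL
    have hjc := hs.right j hB.memR
    refine ⟨fun k hk => ?_, fun k hk => ?_⟩
    · rcases eq_or_ne k i with rfl | hki
      · exact le_rfl
      refine chord_le_chord_left (R := loss c c r n ((I.erase i).erase k) J)
        (v := loss c c r n (I.erase i) (J.erase j)) (v' := loss c c r n (I.erase k) (J.erase j))
        (hB.leL k hk) (hs.left k hk) hjc (hr0 i) (hr0 j) ?_ ?_ ?_
      · rw [Finset.erase_right_comm]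
        exact heq (hs.erase_left k) ⟨Finset.mem_erase.2 ⟨hki.symm, hB.memL⟩, hB.memR,
          fun l hl => hB.leL l (Finset.mem_of_mem_erase hl), hB.leR⟩
      · exact loss_le_chord n (Finset.mem_erase.2 ⟨hki, hk⟩) hB.memR
      -- The residual inequality is `mul_loss_le` in the state where `j` has failed, with one round
      -- fewer, so the induction hypothesis applies to it.
      · have hs' := hs.erase_right j
        exact mul_loss_le hr0 hs' hB.memL hB.leL hk (fun j' h => (ih hs' h).1)
          fun j' h => heq hs' h
    · rcases eq_or_ne k j with rfl | hkj
      · exact le_rfl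
      have hjk := hB.leR k hk
      refine chord_le_chord_right (Y := loss c c r n I ((J.erase j).erase k))
        (ub := loss c c r n (I.erase i) (J.erase j)) (ud := loss c c r n (I.erase i) (J.erase k))
        hic hjc hjk (hr0 i) (hr0 j) ?_ ?_ ?_
      · rw [Finset.erase_right_comm]
        exact heq (hs.erase_right k) ⟨hB.memL, Finset.mem_erase.2 ⟨hkj.symm, hB.memR⟩, hB.leL,
          fun l hl => hB.leR l (Finset.mem_of_mem_erase hl)⟩
      · exact loss_le_chord n hB.memL (Finset.mem_erase.2 ⟨hkj, hk⟩)
      -- If `i` was the last arm of positive mean, the points of `j` and `k` lie on a line through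
      -- the origin with height `c * (1 + c * n)` at `c`. This is at most the terminal loss `c * (n
      -- + 1)`, because `c ≤ 1`.
      · rcases (I.erase i).eq_empty_or_nonempty with he | hne
        · rw [he]
          simp only [loss_empty]
          have : 0 ≤ (r k - r j) * c * n * (1 - c) :=
            mul_nonneg (mul_nonneg (mul_nonneg (by linarith) hc0) n.cast_nonneg) (by linarith)
          push_cast
          linarith
        -- Otherwise the state has a best pair `l`, `j`. The point of `k` lies on or above their
        -- line, so extending the line through `k` and `j` back to `c` gives at most `Z`.
        · obtain ⟨l, hl, hlmin⟩ := (I.erase i).exists_min_image r hne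
          have hs' := hs.erase_left i
          have hB' : Best r (I.erase i) J l j := ⟨hl, hB.memR, hlmin, hB.leR⟩
          have h1 := (ih hs' hB').2 k hk
          have h2 := heq hs' hB'
          have hlc := hs'.left l hl
          rw [← h2] at h1
          have e1 := chord_spec (c := c) (by linarith : r l < r j)
            (loss c c r n ((I.erase i).erase l) J) (loss c c r n (I.erase i) (J.erase j))
          have e2 := chord_spec (c := c) (by linarith : r l < r k)
            (loss c c r n ((I.erase i).erase l) J) (loss c c r n (I.erase i) (J.erase k))
          rw [← h2] at e1
          have h3 : (r k - r l) * loss c c r (n + 1) (I.erase i) J ≤ _ :=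
            mul_le_mul_of_nonneg_left h1 (by linarith)
          rw [e2] at h3
          generalize r k * (1 + _) = yk at *
          generalize r l * (1 + _) = yl at *
          generalize r j * (1 + _) = yj at *
          generalize loss c c r (n + 1) (I.erase i) J = Z at *
          have h4 := mul_le_mul_of_nonneg_left h3 (by linarith : 0 ≤ r j - c)
          have e4 : (r k - c) * ((r j - r l) * Z) =
            (r k - c) * ((r j - c) * yl + (c - r l) * yj) := by rw [e1]
          refine nonneg_of_mul_nonneg_right (a := c - r l) ?_ (by linarith)
          linarith

lemma loss_eq_chord (hr0 : ∀ i, 0 ≤ r i) (hc0 : 0 ≤ c) (hc1 : c ≤ 1) (n : ℕ) {I J : Finset ι}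
    {i j : ι} (hs : Separated c r I J) (hB : Best r I J i j) :
    loss c c r (n + 1) I J =
      chord c (r i) (r j) (loss c c r n (I.erase i) J) (loss c c r n I (J.erase j)) :=
  loss_eq_chord_of_le hs hB.memL hB.memR (chord_best_le hr0 hc0 hc1 n hs hB).1
    (chord_best_le hr0 hc0 hc1 n hs hB).2

/-! ### Growth of the loss with the number of rounds. -/

lemma chord_zero {a b : ℝ} (h : a < b) : chord c a b 0 0 = c := by
  rw [chord, div_eq_iff (by linarith)]
  ring

/-- The endpoints rise by at most `a * δ` and `b * δ`; these two bounds lie on a line through the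
origin, which has height `c * δ` at `c`. -/
lemma chord_sub_le {a b u u' v v' δ : ℝ} (ha : a < c) (hb : c < b) (ha0 : 0 ≤ a) (hb0 : 0 ≤ b)
    (hu : u' - u ≤ δ) (hv : v' - v ≤ δ) : chord c a b u' v' - chord c a b u v ≤ c * δ := by
  have e1 := chord_spec (c := c) (ha.trans hb) u v
  have e2 := chord_spec (c := c) (ha.trans hb) u' v'
  refine le_of_mul_le_mul_left ?_ (by linarith : 0 < b - a)
  have h1 := mul_le_mul_of_nonneg_left hu (mul_nonneg (sub_nonneg.2 hb.le) ha0)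
  have h2 := mul_le_mul_of_nonneg_left hv (mul_nonneg (sub_nonneg.2 ha.le) hb0)
  linarith

/-- With one more round to go, the move that was optimal before is still available. An extra round
matters only after a failure, which has probability `r i < c` for a single arm and `c` for a
balanced pair; hence the factor `c`. -/
lemma loss_add_two_sub_le (hr0 : ∀ i, 0 ≤ r i) {I J : Finset ι} (hs : Separated c r I J) {n : ℕ}
    {δ : ℝ} (hI : I.Nonempty) (hδ : 0 ≤ δ)
    (h : ∀ {I J : Finset ι}, Separated c r I J → loss c c r (n + 1) I J - loss c c r n I J ≤ δ) :
    loss c c r (n + 2) I J - loss c c r (n + 1) I J ≤ c * δ := by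
  rcases J.eq_empty_or_nonempty with rfl | hJ
  · obtain ⟨i, hi, e⟩ := exists_loss_eq_single (c := c) (L := c) (r := r) n hI
    have h1 := loss_le_single (c := c) (L := c) (r := r) (n + 1) hi
    have h2 := mul_le_mul_of_nonneg_left (h (hs.erase_left i)) (hr0 i)
    have h3 := mul_le_mul_of_nonneg_right (hs.left i hi).le hδ
    linarith
  · obtain ⟨i, hi, j, hj, e⟩ := exists_loss_eq_chord (c := c) (L := c) (r := r) n hI hJ
    have h1 := loss_le_chord (c := c) (L := c) (r := r) (n + 1) hi hj
    have h2 := chord_sub_le (hs.left i hi) (hs.right j hj) (hr0 i) (hr0 j) (h (hs.erase_left i))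
      (h (hs.erase_right j))
    linarith

lemma loss_succ_sub_le (hr0 : ∀ i, 0 ≤ r i) (hc0 : 0 ≤ c) (hc1 : c ≤ 1) (n : ℕ) :
    ∀ {I J : Finset ι}, Separated c r I J → loss c c r (n + 1) I J - loss c c r n I J ≤ c := by
  induction n with
  | zero =>
    intro I J hs
    rcases I.eq_empty_or_nonempty with rfl | ⟨i, hi⟩
    · simp [loss_empty]
    rcases J.eq_empty_or_nonempty with rfl | ⟨j, hj⟩
    · have := loss_le_single (c := c) (L := c) (r := r) 0 hi
      have := hs.left i hi
      simp_all
      linarith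
    · have := loss_le_chord (c := c) (L := c) (r := r) 0 hi hj
      simp only [loss_zero] at this
      rw [chord_zero ((hs.left i hi).trans (hs.right j hj))] at this
      simpa using this
  | succ n ih =>
    intro I J hs
    rcases I.eq_empty_or_nonempty with rfl | hI
    · simp only [loss_empty]; push_cast; linarith
    · have := loss_add_two_sub_le hr0 hs hI hc0 ih
      nlinarith

/-- Waiting costs at least `1 - c` of the high reward. -/
lemma loss_add_two_sub_le_sq (hr0 : ∀ i, 0 ≤ r i) (hc0 : 0 ≤ c) (hc1 : c ≤ 1) (n : ℕ)
    {I J : Finset ι} (hs : Separated c r I J) (hI : I.Nonempty) :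
    loss c c r (n + 2) I J - loss c c r (n + 1) I J ≤ c * c :=
  loss_add_two_sub_le hr0 hs hI hc0 fun h => loss_succ_sub_le hr0 hc0 hc1 n h

lemma loss_le_mul (hr0 : ∀ i, 0 ≤ r i) (hc0 : 0 ≤ c) (hc1 : c ≤ 1) (n : ℕ) {I J : Finset ι}
    (hs : Separated c r I J) : loss c c r n I J ≤ c * n := by
  induction n with
  | zero => simp
  | succ n ih =>
    have := loss_succ_sub_le hr0 hc0 hc1 n hs
    push_cast
    linarith

lemma loss_mono (hr0 : ∀ i, 0 ≤ r i) (hc0 : 0 ≤ c) (n : ℕ) :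
    ∀ {I J : Finset ι}, Separated c r I J → loss c c r n I J ≤ loss c c r (n + 1) I J := by
  induction n with
  | zero =>
    intro I J hs
    rcases I.eq_empty_or_nonempty with rfl | hI
    · simp [loss_empty, hc0]
    rcases J.eq_empty_or_nonempty with rfl | hJ
    · obtain ⟨i, hi, e⟩ := exists_loss_eq_single (c := c) (L := c) (r := r) 0 hI
      rw [e]
      simpa using hr0 i
    · obtain ⟨i, hi, j, hj, e⟩ := exists_loss_eq_chord (c := c) (L := c) (r := r) 0 hI hJ
      simp only [loss_zero] at e
      rw [chord_zero ((hs.left i hi).trans (hs.right j hj))] at e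
      rw [e]
      simpa using hc0
  | succ n ih =>
    intro I J hs
    rcases I.eq_empty_or_nonempty with rfl | hI
    · simp only [loss_empty]; push_cast; linarith
    rcases J.eq_empty_or_nonempty with rfl | hJ
    · obtain ⟨i, hi, e⟩ := exists_loss_eq_single (c := c) (L := c) (r := r) (n + 1) hI
      have h1 := loss_le_single (c := c) (L := c) (r := r) n hi
      have h2 := mul_le_mul_of_nonneg_left (ih (hs.erase_left i)) (hr0 i)
      linarith
    · obtain ⟨i, hi, j, hj, e⟩ := exists_loss_eq_chord (c := c) (L := c) (r := r) (n + 1) hI hJ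
      have h1 := loss_le_chord (c := c) (L := c) (r := r) n hi hj
      have h2 := chord_sub_le (c := c) (δ := 0) (hs.left i hi) (hs.right j hj) (hr0 i) (hr0 j)
        (sub_nonpos.2 (ih (hs.erase_left i))) (sub_nonpos.2 (ih (hs.erase_right j)))
      linarith

/-! ### The linear gap and the price of safety. -/

/-- Exploring a best arm of `J`, if it was safe, would be better than a best pair, by an amount
that grows linearly. -/
lemma exists_linear_gap (hr0 : ∀ i, 0 < r i) (hr1 : ∀ i, r i < 1) (hc0 : 0 < c) (hc1 : c ≤ 1)
    (m : ℕ) : ∀ {I J : Finset ι} {j : ι}, I.card + J.card ≤ m → Separated c r I J → j ∈ J →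
    (∀ k ∈ J, r j ≤ r k) → ∃ η > 0, ∃ C, ∀ n : ℕ,
      r j * (1 + loss c c r n I (J.erase j)) + η * n - C ≤ loss c c r (n + 1) I J := by
  have hr0' : ∀ i, 0 ≤ r i := fun i => (hr0 i).le
  induction m with
  | zero =>
    intro I J j hm _ hj
    have := Finset.card_pos.2 ⟨j, hj⟩
    omega
  | succ m ih =>
    intro I J j hm hs hj hjmin
    have hJ1 : (J.erase j).card + 1 = J.card := Finset.card_erase_add_one hj
    rcases I.eq_empty_or_nonempty with rfl | hI
    -- In a terminal state the loss `c * (n + 1)` is compared with `r j * (1 + c * n)`, which fixes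
    -- both constants.
    · refine ⟨c * (1 - r j), mul_pos hc0 (sub_pos.2 (hr1 j)), r j - c, fun n => ?_⟩
      simp only [loss_empty]
      push_cast
      linarith
    obtain ⟨i, hi, himin⟩ := I.exists_min_image r hI
    have hI1 : (I.erase i).card + 1 = I.card := Finset.card_erase_add_one hi
    have hic := hs.left i hi
    have hjc := hs.right j hj
    -- After `j` failed, the loss lies on a chord starting at the point of `i`. By induction the
    -- other endpoint is below the loss, up to a constant, so the endpoint at `i` is not below it,
    -- up to a constant.
    obtain ⟨C₁, hC₁⟩ : ∃ C, ∀ n : ℕ, loss c c r (n + 1) I (J.erase j) - C ≤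
        r i * (1 + loss c c r n (I.erase i) (J.erase j)) := by
      rcases (J.erase j).eq_empty_or_nonempty with he | hne
      · rw [he]
        exact ⟨0, fun n => by rw [loss_eq_single hr0' n hi himin]; simp⟩
      · obtain ⟨k, hk, hkmin⟩ := (J.erase j).exists_min_image r hne
        have hs' := hs.erase_right j
        obtain ⟨η, hη, C, h⟩ := ih (by omega) hs' hk hkmin
        have hkc := hs'.right k hk
        refine ⟨(c - r i) / (r k - c) * C, fun n => ?_⟩
        have e := loss_eq_chord (c := c) hr0' hc0.le hc1 n hs' ⟨hi, hk, himin, hkmin⟩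
        have e1 := chord_spec (c := c) (hic.trans hkc) (loss c c r n (I.erase i) (J.erase j))
          (loss c c r n I ((J.erase j).erase k))
        rw [← e] at e1
        have h1 := h n
        have h2 : 0 ≤ η * n := by positivity
        refine le_of_mul_le_mul_left ?_ (sub_pos.2 hkc)
        rw [mul_sub, ← mul_assoc, mul_div_cancel₀ _ (sub_pos.2 hkc).ne']
        have h3 := mul_le_mul_of_nonneg_left (by linarith : r k *
          (1 + loss c c r n I ((J.erase j).erase k)) - C ≤ loss c c r (n + 1) I (J.erase j))
          (sub_pos.2 hic).le
        linarith
    obtain ⟨η, hη, C₂, hC₂⟩ := ih (by omega) (hs.erase_left i) hj hjmin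
    set κ := (r j - c) / (r j - r i) with hκ
    have hκ0 : 0 < κ := div_pos (by linarith) (by linarith)
    -- the gap between exploring `i` and exploring `j`
    obtain ⟨C, hC⟩ : ∃ C, ∀ n : ℕ, r i * η * n - C ≤ r i * (1 + loss c c r n (I.erase i) J) -
        r j * (1 + loss c c r n I (J.erase j)) := by
      refine ⟨r i * (C₂ + η) + r j * (C₁ + 1) + 2 * r j, fun n => ?_⟩
      -- The induction hypothesis has one round fewer on its left side; shifting that round costs at
      -- most `r j * c ≤ r j`, plus `η` in the linear term.
      have h1 : r j * loss c c r n (I.erase i) (J.erase j) + η * n - (C₂ + η) - r j ≤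
          loss c c r n (I.erase i) J := by
        rcases n with _ | n
        · have := hC₂ 0
          have h3 := loss_succ_sub_le hr0' hc0.le hc1 0 (hs.erase_left i)
          simp at this h3 ⊢
          nlinarith [hr0 j, hr1 j]
        · have h2 := hC₂ n
          have h3 := loss_succ_sub_le hr0' hc0.le hc1 n ((hs.erase_left i).erase_right j)
          have h4 := mul_le_mul_of_nonneg_left h3 (hr0' j)
          push_cast
          nlinarith [hr0 j]
      have h2 := hC₁ n
      have h3 := loss_mono hr0' hc0.le n (hs.erase_right j)
      have h4 := mul_le_mul_of_nonneg_left h1 (hr0' i)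
      have h5 := mul_le_mul_of_nonneg_left (h3.trans (by linarith [h2] :
        loss c c r (n + 1) I (J.erase j) ≤
          r i * (1 + loss c c r n (I.erase i) (J.erase j)) + C₁)) (hr0' j)
      have h6 : r i * r j ≤ r j := by nlinarith [hr0 j, hr1 i]
      have h7 := hr0 i
      linarith
    refine ⟨κ * (r i * η), mul_pos hκ0 (mul_pos (hr0 i) hη), κ * C, fun n => ?_⟩
    have e := loss_eq_chord (c := c) hr0' hc0.le hc1 n hs ⟨hi, hj, himin, hjmin⟩
    -- `κ` is the weight of `i` in the balanced pair, so the gap over the cost of `j` is `κ` times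
    -- the difference of the two exploration costs.
    have e1 : loss c c r (n + 1) I J = r j * (1 + loss c c r n I (J.erase j)) +
        κ * (r i * (1 + loss c c r n (I.erase i) J) -
          r j * (1 + loss c c r n I (J.erase j))) := by
      rw [e, chord, hκ]
      have : r j - r i ≠ 0 := by linarith
      field_simp
      ring
    have h1 := mul_le_mul_of_nonneg_left (hC n) hκ0.le
    rw [e1]
    linarith

/-- The price of safety: with many rounds to go, exploring any arm at this price per unit of
expected reward is not better than exploring best pairs. -/
lemma exists_price (hr0 : ∀ i, 0 < r i) (hr1 : ∀ i, r i < 1) (hc0 : 0 < c) (hc1 : c ≤ 1)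
    {I J : Finset ι} (hs : Separated c r I J) (hI : I.Nonempty) :
    ∃ N, ∀ n ≥ N, ∃ ν ≥ 0,
      (∀ k ∈ I, loss c c r (n + 1) I J + ν * (c - r k) ≤
        r k * (1 + loss c c r n (I.erase k) J)) ∧
      (∀ k ∈ J, loss c c r (n + 1) I J + ν * (c - r k) ≤
        r k * (1 + loss c c r n I (J.erase k))) := by
  have hr0' : ∀ i, 0 ≤ r i := fun i => (hr0 i).le
  rcases J.eq_empty_or_nonempty with rfl | hJ
  · exact ⟨0, fun n _ => ⟨0, le_rfl, fun k hk => by simpa using loss_le_single n hk, by simp⟩⟩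
  obtain ⟨i, hi, himin⟩ := I.exists_min_image r hI
  obtain ⟨j, hj, hjmin⟩ := J.exists_min_image r hJ
  have hic := hs.left i hi
  have hjc := hs.right j hj
  obtain ⟨η, hη, C, hC⟩ := exists_linear_gap hr0 hr1 hc0 hc1 _ le_rfl hs hj hjmin
  obtain ⟨N, hN⟩ := exists_nat_ge (C / η)
  refine ⟨N, fun n hn => ?_⟩
  have hB : Best r I J i j := ⟨hi, hj, himin, hjmin⟩
  have e := loss_eq_chord (c := c) hr0' hc0.le hc1 n hs hB
  obtain ⟨hl, hr⟩ := chord_best_le (c := c) hr0' hc0.le hc1 n hs hB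
  rw [← e] at hl hr
  have e0 := chord_spec (c := c) (hic.trans hjc) (loss c c r n (I.erase i) J)
    (loss c c r n I (J.erase j))
  rw [← e] at e0
  have hgap : 0 ≤ loss c c r (n + 1) I J - r j * (1 + loss c c r n I (J.erase j)) := by
    have h1 : C ≤ η * n := by
      rw [mul_comm]
      exact (div_le_iff₀ hη).1 (hN.trans (by exact_mod_cast hn))
    linarith [hC n]
  -- Minus the slope of the line through the points of `i` and `j`; the linear gap makes it
  -- nonnegative.
  set ν := (loss c c r (n + 1) I J - r j * (1 + loss c c r n I (J.erase j))) / (r j - c) with hν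
  have hνe : (r j - c) * ν =
      loss c c r (n + 1) I J - r j * (1 + loss c c r n I (J.erase j)) :=
    mul_div_cancel₀ _ (by linarith)
  refine ⟨ν, div_nonneg hgap (by linarith), fun k hk => ?_, fun k hk => ?_⟩
  · have hkc := hs.left k hk
    have e1 := chord_spec (c := c) (hkc.trans hjc) (loss c c r n (I.erase k) J)
      (loss c c r n I (J.erase j))
    have h1 := mul_le_mul_of_nonneg_left (hl k hk) (by linarith : 0 ≤ r j - r k)
    rw [e1] at h1
    refine le_of_mul_le_mul_left ?_ (by linarith : 0 < r j - c)
    have : (r j - c) * (loss c c r (n + 1) I J + ν * (c - r k)) =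
      (r j - c) * loss c c r (n + 1) I J + (c - r k) * ((r j - c) * ν) := by ring
    rw [this, hνe]
    linarith
  · have hkc := hs.right k hk
    have e1 := chord_spec (c := c) (hic.trans hkc) (loss c c r n (I.erase i) J)
      (loss c c r n I (J.erase k))
    have h1 := mul_le_mul_of_nonneg_left (hr k hk) (by linarith : 0 ≤ r k - r i)
    rw [e1] at h1
    refine le_of_mul_le_mul_left ?_ (by linarith : 0 < c - r i)
    have e2 : r i * (1 + loss c c r n (I.erase i) J) =
        loss c c r (n + 1) I J + (c - r i) * ν := by
      refine mul_left_cancel₀ (by linarith : r j - c ≠ 0) ?_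
      have : (r j - c) * (loss c c r (n + 1) I J + (c - r i) * ν) =
        (r j - c) * loss c c r (n + 1) I J + (c - r i) * ((r j - c) * ν) := by ring
      rw [this, hνe]
      linarith
    rw [e2] at h1
    linarith

end Loss

/-! ### Histories, their probabilities and the Bellman equation. -/

/-- The rewards are independent and take the values `xm < xp` only. -/
structure TwoValued {Ω : Type*} [MeasurableSpace Ω] (P : Measure Ω) {K : ℕ} (X : Fin K → Ω → ℝ)
    (xm xp : ℝ) : Prop where
  meas : ∀ i, Measurable (X i)
  indep : iIndepFun X P
  lt : xm < xp
  two : ∀ i, ∀ᵐ ω ∂P, X i ω = xm ∨ X i ω = xp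

/-- The probability of the history `h`. -/
def weight {Ω : Type*} [MeasurableSpace Ω] (P : Measure Ω) {K : ℕ} (X : Fin K → Ω → ℝ)
    (h : History K) : ℝ := P.real (agree X h)

/-- The expected utility of the next `n` rounds, on the event of the history `h`. -/
def value {Ω : Type*} [MeasurableSpace Ω] (P : Measure Ω) {K : ℕ} (X : Fin K → Ω → ℝ)
    (alg : Algorithm K) (n : ℕ) (h : History K) : ℝ :=
  ∫ ω in agree X h, runUtility P X alg (fun a => reward X a ω) n h ∂P

/-- The probability that arm `i` has not the reward `xp`. -/
def failProb {Ω : Type*} [MeasurableSpace Ω] (P : Measure Ω) {K : ℕ} (X : Fin K → Ω → ℝ)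
    (xp : ℝ) (i : Fin K) : ℝ := 1 - P.real {ω | X i ω = xp}

/-- The expected utility of the next `n + 1` rounds, on the event of the history `h`, if arm `a`
is realized first. -/
def armValue {Ω : Type*} [MeasurableSpace Ω] (P : Measure Ω) {K : ℕ} (X : Fin K → Ω → ℝ)
    (xm xp : ℝ) (alg : Algorithm K) (n : ℕ) (h : History K) : Arm K → ℝ
  | none => value P X alg n (h ++ [(none, 0)])
  | some i => xp * weight P X (h ++ [(some i, xp)]) + xm * weight P X (h ++ [(some i, xm)]) +
      (value P X alg n (h ++ [(some i, xp)]) + value P X alg n (h ++ [(some i, xm)]))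

section Agree

variable {Ω : Type*} {K : ℕ} {X : Fin K → Ω → ℝ} {h : History K}

lemma agree_append (h : History K) (a : Arm K) (v : ℝ) :
    agree X (h ++ [(a, v)]) = agree X h ∩ {ω | reward X a ω = v} := by
  ext ω
  simp [agree, or_imp, forall_and]

lemma agree_append_none (h : History K) : agree X (h ++ [(none, 0)]) = agree X h := by
  rw [agree_append]
  simp [reward]

lemma agree_append_of_mem {a : Arm K} {v : ℝ} (hmem : (a, v) ∈ h) :
    agree X (h ++ [(a, v)]) = agree X h := by
  rw [agree_append]
  exact Set.inter_eq_left.2 fun ω hω => hω _ hmem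

lemma agree_append_of_mem_ne {a : Arm K} {v v' : ℝ} (hmem : (a, v) ∈ h) (hv : v' ≠ v) :
    agree X (h ++ [(a, v')]) = ∅ := by
  rw [agree_append]
  ext ω
  simp only [Set.mem_inter_iff, Set.mem_ofPred_eq, Set.mem_empty_iff_false, iff_false, not_and]
  intro hω hv'
  exact hv (hv'.symm.trans (hω _ hmem))

end Agree

variable {Ω : Type*} [MeasurableSpace Ω] {P : Measure Ω} {K : ℕ}
  {X : Fin K → Ω → ℝ} {xm xp : ℝ} {alg : Algorithm K} {h : History K} {i : Fin K} {n : ℕ}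

lemma measurable_reward (hX : ∀ i, Measurable (X i)) : ∀ a, Measurable (reward X a)
  | none => measurable_const
  | some i => hX i

lemma measurableSet_agree (hX : ∀ i, Measurable (X i)) (h : History K) :
    MeasurableSet (agree X h) := by
  induction h using List.reverseRecOn with
  | nil => simp [agree]
  | append_singleton h e ih =>
    obtain ⟨a, v⟩ := e
    rw [agree_append]
    exact ih.inter (measurable_reward hX a (measurableSet_singleton v))

lemma weight_nonneg : 0 ≤ weight P X h := measureReal_nonneg

lemma weight_append_of_mem {a : Arm K} {v : ℝ} (hmem : (a, v) ∈ h) :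
    weight P X (h ++ [(a, v)]) = weight P X h := by
  rw [weight, agree_append_of_mem hmem, weight]

lemma weight_append_of_mem_ne {a : Arm K} {v v' : ℝ} (hmem : (a, v) ∈ h) (hv : v' ≠ v) :
    weight P X (h ++ [(a, v')]) = 0 := by
  rw [weight, agree_append_of_mem_ne hmem hv, measureReal_empty]

lemma weight_append_none : weight P X (h ++ [(none, 0)]) = weight P X h := by
  rw [weight, agree_append_none, weight]

lemma value_zero : value P X alg 0 h = 0 := by simp [value, runUtility]

lemma value_append_of_mem_ne {a : Arm K} {v v' : ℝ} (hmem : (a, v) ∈ h) (hv : v' ≠ v) :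
    value P X alg n (h ++ [(a, v')]) = 0 := by
  rw [value, agree_append_of_mem_ne hmem hv, Measure.restrict_empty, integral_zero_measure]

lemma exists_mem_agree (hw : weight P X h ≠ 0) : (agree X h).Nonempty := by
  by_contra hne
  rw [Set.not_nonempty_iff_eq_empty] at hne
  rw [weight, hne, measureReal_empty] at hw
  exact hw rfl

lemma eq_zero_of_none_mem (hw : weight P X h ≠ 0) {v : ℝ} (hmem : (none, v) ∈ h) : v = 0 := by
  obtain ⟨ω, hω⟩ := exists_mem_agree hw
  exact (hω _ hmem).symm

lemma value_of_weight_eq_zero [IsFiniteMeasure P] (hw : weight P X h = 0) : value P X alg n h = 0 := by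
  rw [value, Measure.restrict_eq_zero.2, integral_zero_measure]
  exact (measureReal_eq_zero_iff).1 hw

lemma weight_mul_posteriorMean [IsFiniteMeasure P] (h : History K) (a : Arm K) :
    weight P X h * posteriorMean P X h a = ∫ ω in agree X h, reward X a ω ∂P := by
  rw [posteriorMean, ProbabilityTheory.cond, integral_smul_measure, weight]
  by_cases h0 : P (agree X h) = 0
  · rw [Measure.restrict_eq_zero.2 h0]
    simp
  · rw [ENNReal.toReal_inv, smul_eq_mul, ← mul_assoc, measureReal_def, mul_inv_cancel₀, one_mul]
    exact (ENNReal.toReal_pos h0 (measure_ne_top _ _)).ne'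

lemma utility_eq_value (alg : Algorithm K) (n : ℕ) :
    utility P X n alg = value P X alg n [] := by
  simp [utility, value, agree]

namespace TwoValued

lemma ae_eq_indicator (H : TwoValued P X xm xp) (i : Fin K) (f : ℝ → Ω → ℝ) :
    (fun ω => f (X i ω) ω) =ᵐ[P] fun ω => {ω | X i ω = xp}.indicator (f xp) ω +
      {ω | X i ω = xm}.indicator (f xm) ω := by
  filter_upwards [H.two i] with ω hω
  have hne := H.lt.ne
  rcases hω with e | e
  · have h1 : ω ∉ {ω | X i ω = xp} := by simpa [e] using hne
    have h2 : ω ∈ {ω | X i ω = xm} := e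
    rw [Set.indicator_of_notMem h1, Set.indicator_of_mem h2, e, zero_add]
  · have h1 : ω ∉ {ω | X i ω = xm} := by simpa [e] using hne.symm
    have h2 : ω ∈ {ω | X i ω = xp} := e
    rw [Set.indicator_of_notMem h1, Set.indicator_of_mem h2, e, add_zero]

lemma measurableSet_eq (H : TwoValued P X xm xp) (i : Fin K) (v : ℝ) :
    MeasurableSet {ω | X i ω = v} := H.meas i (measurableSet_singleton v)

/-- Observations of other arms carry no information about arm `i`. -/
lemma weight_append_of_unexplored (H : TwoValued P X xm xp) (hi : i ∈ unexplored h) (v : ℝ) :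
    weight P X (h ++ [(some i, v)]) = weight P X h * P.real {ω | X i ω = v} := by
  have hi' : ∀ r, (some i, r) ∉ h := by simpa [unexplored] using hi
  -- The event of `h` is measurable with respect to the other arms, because `i` does not occur in
  -- `h`.
  have hind := indep_iSup_of_disjoint (S := {i}ᶜ) (T := {i})
    (fun j => (H.meas j).comap_le) H.indep.iIndep disjoint_compl_left
  have hm : MeasurableSet[⨆ j ∈ ({i}ᶜ : Set (Fin K)),
      MeasurableSpace.comap (X j) inferInstance] (agree X h) := by
    clear hi
    induction h using List.reverseRecOn with
    | nil => simp [agree]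
    | append_singleton h e ih =>
      obtain ⟨a, w⟩ := e
      rw [agree_append]
      refine MeasurableSet.inter (ih fun r hr => hi' r (by simp [hr])) ?_
      cases a with
      | none =>
        by_cases hw : (0 : ℝ) = w <;> simp [reward, hw]
      | some j =>
        have hji : j ∈ ({i}ᶜ : Set (Fin K)) := by
          rintro rfl
          exact hi' w (by simp)
        exact (le_iSup₂_of_le (f := fun j (_ : j ∈ ({i}ᶜ : Set (Fin K))) =>
          MeasurableSpace.comap (X j) inferInstance) j hji le_rfl) _
          ⟨{w}, measurableSet_singleton w, rfl⟩
  have hm' : MeasurableSet[⨆ j ∈ ({i} : Set (Fin K)),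
      MeasurableSpace.comap (X j) inferInstance] {ω | X i ω = v} :=
    (le_iSup₂_of_le (f := fun j (_ : j ∈ ({i} : Set (Fin K))) =>
      MeasurableSpace.comap (X j) inferInstance) i rfl le_rfl) _
      ⟨{v}, measurableSet_singleton v, rfl⟩
  have := (Indep_iff _ _ _).1 hind _ _ hm hm'
  rw [weight, agree_append, weight, measureReal_def, measureReal_def, measureReal_def,
    ← ENNReal.toReal_mul, ← this]
  rfl


lemma integrable_comp (H : TwoValued P X xm xp) (i : Fin K) {f : ℝ → Ω → ℝ}
    (hf : ∀ v, Integrable (f v) P) : Integrable (fun ω => f (X i ω) ω) P :=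
  (((hf xp).indicator (H.measurableSet_eq i xp)).add
    ((hf xm).indicator (H.measurableSet_eq i xm))).congr (H.ae_eq_indicator i f).symm

/-- The algorithm's future depends on the reward of `i` through the recorded history. Splitting by
its two values freezes that history in each part, which is what the Bellman equation needs. -/
lemma setIntegral_comp (H : TwoValued P X xm xp) (h : History K) (i : Fin K) {f : ℝ → Ω → ℝ}
    (hf : ∀ v, Integrable (f v) P) :
    ∫ ω in agree X h, f (X i ω) ω ∂P = ∫ ω in agree X (h ++ [(some i, xp)]), f xp ω ∂P +
      ∫ ω in agree X (h ++ [(some i, xm)]), f xm ω ∂P := by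
  rw [integral_congr_ae (ae_restrict_of_ae (H.ae_eq_indicator i f)), integral_add,
    setIntegral_indicator (H.measurableSet_eq i xp),
    setIntegral_indicator (H.measurableSet_eq i xm), agree_append, agree_append]
  · rfl
  · exact ((hf xp).indicator (H.measurableSet_eq i xp)).integrableOn
  · exact ((hf xm).indicator (H.measurableSet_eq i xm)).integrableOn

lemma weight_append_xp (H : TwoValued P X xm xp) (hi : i ∈ unexplored h) :
    weight P X (h ++ [(some i, xp)]) = weight P X h * (1 - failProb P X xp i) := by
  rw [H.weight_append_of_unexplored hi, failProb]
  ring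

variable [IsProbabilityMeasure P]

lemma integrable_runUtility (H : TwoValued P X xm xp) (alg : Algorithm K) (n : ℕ) :
    ∀ h, Integrable (fun ω => runUtility P X alg (fun a => reward X a ω) n h) P := by
  induction n with
  | zero => intro h; simp [runUtility]
  | succ n ih =>
    intro h
    simp only [runUtility]
    refine (integrable_const _).add (integrable_finsetSum _ fun a _ => Integrable.const_mul ?_ _)
    cases a with
    | none => exact ih (h ++ [(none, 0)])
    | some i =>
      exact H.integrable_comp i
        (f := fun v ω => runUtility P X alg (fun a => reward X a ω) n (h ++ [(some i, v)]))
        fun v => ih _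

lemma weight_eq_add (H : TwoValued P X xm xp) (h : History K) (i : Fin K) :
    weight P X h = weight P X (h ++ [(some i, xp)]) + weight P X (h ++ [(some i, xm)]) := by
  have := H.setIntegral_comp h i (f := fun _ _ => 1) fun _ => integrable_const _
  simpa [weight] using this

lemma setIntegral_reward (H : TwoValued P X xm xp) (h : History K) (i : Fin K) :
    ∫ ω in agree X h, X i ω ∂P = xp * weight P X (h ++ [(some i, xp)]) +
      xm * weight P X (h ++ [(some i, xm)]) := by
  have := H.setIntegral_comp h i (f := fun v _ => v) fun _ => integrable_const _
  simpa [weight, mul_comm] using this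

lemma weight_mul_posteriorMean_some (H : TwoValued P X xm xp) (h : History K) (i : Fin K) :
    weight P X h * posteriorMean P X h (some i) = xp * weight P X (h ++ [(some i, xp)]) +
      xm * weight P X (h ++ [(some i, xm)]) := by
  rw [weight_mul_posteriorMean]
  exact H.setIntegral_reward h i

/-- The Bellman equation. -/
lemma value_succ (H : TwoValued P X xm xp) (alg : Algorithm K) (n : ℕ) (h : History K) :
    value P X alg (n + 1) h = ∑ a, (alg h).1 a * armValue P X xm xp alg n h a := by
  have hint : ∀ a : Arm K, Integrable (fun ω => (alg h).1 a *
      runUtility P X alg (fun a => reward X a ω) n (h ++ [(a, reward X a ω)])) P := by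
    intro a
    refine Integrable.const_mul ?_ _
    cases a with
    | none => exact H.integrable_runUtility alg n (h ++ [(none, 0)])
    | some i =>
      exact H.integrable_comp i
        (f := fun v ω => runUtility P X alg (fun a => reward X a ω) n (h ++ [(some i, v)]))
        fun v => H.integrable_runUtility alg n _
  simp only [value, runUtility]
  rw [integral_add (integrable_const _)
    (integrable_finsetSum _ fun a _ => (hint a).integrableOn),
    integral_finsetSum _ fun a _ => (hint a).integrableOn, setIntegral_const, roundReward,
    smul_eq_mul, Finset.mul_sum, ← Finset.sum_add_distrib]
  refine Finset.sum_congr rfl fun a _ => ?_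
  rw [integral_const_mul]
  have e : P.real (agree X h) * ((alg h).1 a * posteriorMean P X h a) =
      (alg h).1 a * (weight P X h * posteriorMean P X h a) := by rw [weight]; ring
  rw [e, ← mul_add]
  congr 1
  cases a with
  | none =>
    rw [weight_mul_posteriorMean, armValue, value, agree_append_none]
    simp [reward]
  | some i =>
    rw [H.weight_mul_posteriorMean_some, armValue]
    congr 1
    exact H.setIntegral_comp h i
      (f := fun v ω => runUtility P X alg (fun a => reward X a ω) n (h ++ [(some i, v)]))
      fun v => H.integrable_runUtility alg n _

lemma measure_eq_xm (H : TwoValued P X xm xp) (i : Fin K) :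
    P.real {ω | X i ω = xm} = failProb P X xp i := by
  have := H.weight_eq_add [] i
  simp only [weight, agree_append] at this
  simp only [agree, reward] at this
  simp at this
  rw [failProb]
  linarith

lemma mean_eq (H : TwoValued P X xm xp) (i : Fin K) :
    mean P X i = xp - (xp - xm) * failProb P X xp i := by
  have h1 := H.setIntegral_reward [] i
  have h2 : ∫ ω in agree X [], X i ω ∂P = mean P X i := by simp [mean, agree]
  have h3 : weight P X [(some i, xm)] = failProb P X xp i := by
    rw [← H.measure_eq_xm i]; simp [weight, agree, reward]
  have h4 : weight P X [(some i, xp)] = 1 - failProb P X xp i := by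
    rw [failProb]; simp [weight, agree, reward]
  rw [h2, List.nil_append, List.nil_append, h3, h4] at h1
  linarith

lemma weight_append_xm (H : TwoValued P X xm xp) (hi : i ∈ unexplored h) :
    weight P X (h ++ [(some i, xm)]) = weight P X h * failProb P X xp i := by
  rw [H.weight_append_of_unexplored hi, H.measure_eq_xm]

/-- With any other recorded reward, both one-step extensions by `i` would be null, and their weights
sum to that of `h`. -/
lemma eq_or_eq_of_mem (H : TwoValued P X xm xp) (hw : weight P X h ≠ 0) {v : ℝ}
    (hmem : (some i, v) ∈ h) : v = xm ∨ v = xp := by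
  by_contra! hv
  have := H.weight_eq_add h i
  rw [weight_append_of_mem_ne hmem hv.1.symm, weight_append_of_mem_ne hmem hv.2.symm] at this
  exact hw (by linarith)

/-- No more than `xp` can be earned per round. -/
lemma value_le (H : TwoValued P X xm xp) (hxp : 0 ≤ xp) (alg : Algorithm K) (n : ℕ) :
    ∀ h, value P X alg n h ≤ weight P X h * (n * xp) := by
  induction n with
  | zero => intro h; simp [value_zero]
  | succ n ih =>
    intro h
    have hsum := (alg h).2.2
    rw [H.value_succ, ← one_mul (weight P X h * _), ← hsum, Finset.sum_mul]
    refine Finset.sum_le_sum fun a _ => mul_le_mul_of_nonneg_left ?_ ((alg h).2.1 a)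
    cases a with
    | none =>
      have := ih (h ++ [(none, 0)])
      rw [weight_append_none] at this
      rw [armValue]
      have := mul_nonneg (weight_nonneg (P := P) (X := X) (h := h)) hxp
      push_cast
      linarith
    | some i =>
      have h1 := ih (h ++ [(some i, xp)])
      have h2 := ih (h ++ [(some i, xm)])
      have h3 := mul_le_mul_of_nonneg_right H.lt.le
        (weight_nonneg (P := P) (X := X) (h := h ++ [(some i, xm)]))
      rw [armValue, H.weight_eq_add h i]
      push_cast
      linarith

end TwoValued

/-! ### States of the search and terminal states. -/

section States

variable {K : ℕ} {h : History K} {i : Fin K} {μ : Fin K → ℝ} {s : Finset (Fin K)}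

lemma mem_unexplored : i ∈ unexplored h ↔ ∀ v, (some i, v) ∉ h := by simp [unexplored]

lemma unexplored_append_none (v : ℝ) : unexplored (h ++ [(none, v)]) = unexplored h := by
  ext j
  simp [unexplored]

lemma unexplored_append_some (i : Fin K) (v : ℝ) :
    unexplored (h ++ [(some i, v)]) = (unexplored h).erase i := by
  ext j
  simp only [mem_unexplored, Finset.mem_erase, List.mem_append, List.mem_singleton, Prod.mk.injEq,
    Option.some.injEq, not_or, not_and]
  constructor
  · exact fun hj => ⟨fun hji => (hj v).2 hji rfl, fun w => (hj w).1⟩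
  · exact fun hj w => ⟨hj.2 w, fun hji => absurd hji hj.1⟩

lemma unexplored_append_of_notMem (hi : i ∉ unexplored h) (v : ℝ) :
    unexplored (h ++ [(some i, v)]) = unexplored h := by
  rw [unexplored_append_some, Finset.erase_eq_of_notMem hi]

lemma mem_above : i ∈ above μ s ↔ i ∈ s ∧ 0 < μ i := by simp [above]

lemma mem_below : i ∈ below μ s ↔ i ∈ s ∧ μ i < 0 := by simp [below]

lemma above_erase (i : Fin K) : above μ (s.erase i) = (above μ s).erase i := by
  ext j
  simp [mem_above, and_assoc]

lemma below_erase (i : Fin K) : below μ (s.erase i) = (below μ s).erase i := by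
  ext j
  simp [mem_below, and_assoc]

lemma above_erase_of_neg (hi : μ i < 0) : above μ (s.erase i) = above μ s := by
  rw [above_erase, Finset.erase_eq_of_notMem]
  simp [mem_above, hi.le]

lemma below_erase_of_pos (hi : 0 < μ i) : below μ (s.erase i) = below μ s := by
  rw [below_erase, Finset.erase_eq_of_notMem]
  simp [mem_below, hi.le]

/-- The loss in state `s`. -/
def stateLoss (μ : Fin K → ℝ) (c L : ℝ) (r : Fin K → ℝ) (n : ℕ) (s : Finset (Fin K)) : ℝ :=
  loss c L r n (above μ s) (below μ s)

/-- A state without arms of positive mean is terminal, and conversely. -/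
lemma isTerminal_iff (hμ : ∀ i, μ i ≠ 0) : IsTerminal μ s ↔ above μ s = ∅ := by
  rw [IsTerminal]
  constructor
  · intro he
    by_contra hne
    obtain ⟨i, hi⟩ := Finset.nonempty_iff_ne_empty.2 hne
    rw [mem_above] at hi
    have : (Pi.single i 1 : Fin K → ℝ) ∈ safe μ s := by
      refine ⟨single_mem_stdSimplex ℝ i, fun j hj => ?_, ?_⟩
      · have hji : j ≠ i := by
          rintro rfl
          exact hj hi.1
        exact Pi.single_eq_of_ne hji 1
      · rw [Finset.sum_eq_single i]
        · simpa using hi.2.le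
        · intro j _ hj
          simp [Pi.single_eq_of_ne hj]
        · exact fun h => absurd hi.1 h
    rw [he] at this
    exact this
  · intro he
    rw [Set.eq_empty_iff_forall_notMem]
    rintro p ⟨hp, hps, hsum⟩
    have hneg : ∀ j ∈ s, μ j < 0 := by
      intro j hj
      by_contra! hj'
      have : j ∈ above μ s := mem_above.2 ⟨hj, lt_of_le_of_ne hj' (hμ j).symm⟩
      simp [he] at this
    have hterm : ∀ j ∈ s, p j * μ j ≤ 0 := fun j hj =>
      mul_nonpos_of_nonneg_of_nonpos (hp.1 j) (hneg j hj).le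
    have h0 : ∀ j, p j = 0 := by
      intro j
      by_cases hj : j ∈ s
      · have := (Finset.sum_eq_zero_iff_of_nonpos hterm).1
          (le_antisymm (Finset.sum_nonpos hterm) hsum) j hj
        exact (mul_eq_zero.1 this).resolve_right (hμ j)
      · exact hps j hj
    have := hp.2
    simp [h0] at this

end States

/-! ### Upper bounds for arbitrary safe algorithms. -/

lemma weight_mul_posteriorMean_of_mem [IsFiniteMeasure P]
    (hX : ∀ i, Measurable (X i)) {a : Arm K} {v : ℝ} (hmem : (a, v) ∈ h) :
    weight P X h * posteriorMean P X h a = weight P X h * v := by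
  rw [weight_mul_posteriorMean, setIntegral_congr_fun (measurableSet_agree hX h)
    (g := fun _ => v) (fun ω hω => hω _ hmem), setIntegral_const]
  rfl

namespace TwoValued

variable [IsProbabilityMeasure P]

lemma weight_mul_posteriorMean_of_unexplored (H : TwoValued P X xm xp) (hi : i ∈ unexplored h) :
    weight P X h * posteriorMean P X h (some i) = weight P X h * mean P X i := by
  rw [H.weight_mul_posteriorMean_some, H.weight_append_xm hi, H.weight_append_xp hi, H.mean_eq]
  ring

/-- An arm that was realized in a history without reward `xp` has the reward `xm`. -/
lemma mem_of_notMem_unexplored (H : TwoValued P X xm xp) (hw : weight P X h ≠ 0)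
    (hf : ∀ i, (some i, xp) ∉ h) (hi : i ∉ unexplored h) : (some i, xm) ∈ h := by
  simp only [mem_unexplored, not_forall, not_not] at hi
  obtain ⟨v, hv⟩ := hi
  rcases H.eq_or_eq_of_mem hw hv with rfl | rfl
  · exact hv
  · exact absurd hv (hf i)

/-- A safe portfolio satisfies the safety constraint for the prior means of the unexplored arms,
if the low reward is nonpositive. -/
lemma sum_unexplored_nonneg (H : TwoValued P X xm xp) (hw : weight P X h ≠ 0) (hxm : xm ≤ 0)
    (hf : ∀ i, (some i, xp) ∉ h) (hsafe : IsSafePortfolio P X h (alg h)) :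
    0 ≤ ∑ i ∈ unexplored h, (alg h).1 (some i) * mean P X i := by
  refine hsafe.trans ?_
  rw [← Finset.sum_filter_add_sum_filter_not Finset.univ (· ∈ unexplored h)]
  have hu : Finset.univ.filter (· ∈ unexplored h) = unexplored h := by ext; simp
  rw [hu]
  refine (add_le_of_nonpos_right (Finset.sum_nonpos fun i hi => ?_)).trans
    (Finset.sum_le_sum fun i hi => ?_)
  · have hmem := H.mem_of_notMem_unexplored hw hf (Finset.mem_filter.1 hi).2
    rw [mul_left_cancel₀ hw (weight_mul_posteriorMean_of_mem H.meas hmem)]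
    exact mul_nonpos_of_nonneg_of_nonpos ((alg h).2.1 _) hxm
  · rw [mul_left_cancel₀ hw (H.weight_mul_posteriorMean_of_unexplored hi)]

/-- The Bellman inequality, with a price `ν` for violating the safety constraint. -/
lemma value_succ_le (H : TwoValued P X xm xp) (hxp : 0 ≤ xp) (hw : weight P X h ≠ 0)
    (hf : ∀ i, (some i, xp) ∉ h) (hsafe : IsSafePortfolio P X h (alg h)) {z : Fin K → ℝ}
    {v D ν : ℝ}
    (hz : ∀ i ∈ unexplored h, value P X alg n (h ++ [(some i, xm)]) ≤
      weight P X (h ++ [(some i, xm)]) * (n * xp - (xp - xm) * z i))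
    (hv : ∀ h', weight P X h' = weight P X h → unexplored h' = unexplored h →
      (∀ i, (some i, xp) ∉ h') → value P X alg n h' ≤ weight P X h' * v)
    (hν : 0 ≤ ν) (hν' : ν = 0 ∨ xm ≤ 0)
    (hD : ∀ i ∈ unexplored h, (n + 1) * xp - (xp - xm) * (failProb P X xp i * (1 + z i)) +
      ν * mean P X i ≤ D)
    (hv0 : v ≤ D) (hvm : xm + v ≤ D) :
    value P X alg (n + 1) h ≤ weight P X h * D := by
  have hw0 : 0 ≤ weight P X h := weight_nonneg
  have hprice : 0 ≤ ν * ∑ i ∈ unexplored h, (alg h).1 (some i) * mean P X i := by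
    rcases hν' with rfl | hxm
    · simp
    · exact mul_nonneg hν (H.sum_unexplored_nonneg hw hxm hf hsafe)
  have hsum := (alg h).2.2
  have hnone : armValue P X xm xp alg n h none ≤ weight P X h * D := by
    have := hv (h ++ [(none, 0)]) weight_append_none (unexplored_append_none 0) (by simpa using hf)
    rw [weight_append_none] at this
    exact this.trans (mul_le_mul_of_nonneg_left hv0 hw0)
  -- Replaying an explored arm earns `xm` and reveals nothing; like the safe arm, it only lets a
  -- round pass.
  have hexp : ∀ i ∉ unexplored h, armValue P X xm xp alg n h (some i) ≤ weight P X h * D := by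
    intro i hi
    have hmem := H.mem_of_notMem_unexplored hw hf hi
    have h1 := hv (h ++ [(some i, xm)]) (weight_append_of_mem hmem)
      (unexplored_append_of_notMem hi xm) (by simpa [H.lt.ne'] using hf)
    rw [armValue, weight_append_of_mem hmem, weight_append_of_mem_ne hmem H.lt.ne',
      value_append_of_mem_ne hmem H.lt.ne']
    rw [weight_append_of_mem hmem] at h1
    have := mul_le_mul_of_nonneg_left hvm hw0
    linarith
  -- A success is bounded by `xp` in every remaining round, a failure by `z`. The price then pays
  -- for the mean of `i`.
  have hun : ∀ i ∈ unexplored h, armValue P X xm xp alg n h (some i) ≤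
      weight P X h * (D - ν * mean P X i) := by
    intro i hi
    have h1 := hz i hi
    have h2 := H.value_le hxp alg n (h ++ [(some i, xp)])
    have h3 := mul_le_mul_of_nonneg_left (hD i hi) hw0
    rw [H.weight_append_xm hi] at h1
    rw [H.weight_append_xp hi] at h2
    rw [armValue, H.weight_append_xm hi, H.weight_append_xp hi]
    linarith
  have hall : ∀ a, armValue P X xm xp alg n h a ≤ weight P X h * (D - ν *
      a.elim 0 fun i => if i ∈ unexplored h then mean P X i else 0) := by
    rintro (_ | i)
    · simpa using hnone
    · by_cases hi : i ∈ unexplored h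
      · simpa [hi] using hun i hi
      · simpa [hi] using hexp i hi
  rw [H.value_succ]
  calc _ ≤ ∑ a, (alg h).1 a * (weight P X h * (D - ν *
      a.elim 0 fun i => if i ∈ unexplored h then mean P X i else 0)) :=
        Finset.sum_le_sum fun a _ => mul_le_mul_of_nonneg_left (hall a) ((alg h).2.1 a)
    _ = weight P X h * (D * ∑ a, (alg h).1 a -
        ν * ∑ i ∈ unexplored h, (alg h).1 (some i) * mean P X i) := by
      have e : ∑ i ∈ unexplored h, (alg h).1 (some i) * mean P X i = ∑ a, (alg h).1 a *
          a.elim 0 fun i => if i ∈ unexplored h then mean P X i else 0 := by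
        rw [Fintype.sum_option]
        simp
      rw [e, Finset.mul_sum, Finset.mul_sum, ← Finset.sum_sub_distrib, Finset.mul_sum]
      exact Finset.sum_congr rfl fun a _ => by ring
    _ ≤ weight P X h * D := by
      rw [hsum]
      exact mul_le_mul_of_nonneg_left (by linarith) hw0

end TwoValued

lemma below_eq_empty {μ : Fin K → ℝ} (hμ : ∀ i, 0 < μ i) (s : Finset (Fin K)) :
    below μ s = ∅ := by
  rw [Finset.eq_empty_iff_forall_notMem]
  intro i hi
  exact (mem_below.1 hi).2.not_gt (hμ i)

namespace TwoValued

/-- The hypotheses of the mixed case, with `c = xp / (xp - xm)`. -/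
structure Mixed (P : Measure Ω) (X : Fin K → Ω → ℝ) (xm xp c : ℝ) : Prop
    extends TwoValued P X xm xp where
  neg : xm < 0
  pos : 0 < xp
  mul_eq : (xp - xm) * c = xp
  ne : ∀ i, mean P X i ≠ 0
  fail_pos : ∀ i, 0 < failProb P X xp i
  fail_lt : ∀ i, failProb P X xp i < 1

namespace Mixed

variable {c : ℝ}

lemma c_pos (H : Mixed P X xm xp c) : 0 < c := by
  refine (mul_pos_iff_of_pos_left (sub_pos.2 H.lt)).1 ?_
  rw [H.mul_eq]
  exact H.pos

lemma c_lt (H : Mixed P X xm xp c) : c < 1 := by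
  have := H.mul_eq
  nlinarith [H.neg, H.lt]

end Mixed

lemma failProb_le_one : failProb P X xp i ≤ 1 := sub_le_self _ measureReal_nonneg

variable [IsProbabilityMeasure P]

lemma failProb_nonneg : 0 ≤ failProb P X xp i := sub_nonneg.2 measureReal_le_one

/-- If all arms have a positive mean, exploring single arms in the best order is optimal. -/
lemma value_le_of_pos (H : TwoValued P X xm xp) (hxp : 0 ≤ xp) (hμ : ∀ i, 0 < mean P X i)
    {c L : ℝ} (hL : (xp - xm) * L = xp - max xm 0) (hsafe : IsSafe P X alg) (n : ℕ) :
    ∀ h, (∀ i, (some i, xp) ∉ h) → value P X alg n h ≤ weight P X h *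
      (n * xp - (xp - xm) * stateLoss (mean P X) c L (failProb P X xp) n (unexplored h)) := by
  have hd : 0 < xp - xm := sub_pos.2 H.lt
  have hr0 : ∀ i, 0 ≤ failProb P X xp i := fun i => failProb_nonneg
  have hr1 : ∀ i, failProb P X xp i ≤ 1 := fun i => failProb_le_one
  have hL0 : 0 ≤ L := by
    refine nonneg_of_mul_nonneg_right (a := xp - xm) ?_ hd
    rw [hL]
    exact sub_nonneg.2 (max_le H.lt.le hxp)
  have hrL : ∀ i, failProb P X xp i ≤ L := by
    intro i
    refine le_of_mul_le_mul_left ?_ hd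
    rw [hL]
    have h1 := H.mean_eq i
    have h2 := hμ i
    have h3 : (xp - xm) * failProb P X xp i ≤ (xp - xm) * 1 :=
      mul_le_mul_of_nonneg_left (hr1 i) hd.le
    have : max xm 0 ≤ xp - (xp - xm) * failProb P X xp i := max_le (by linarith) (by linarith)
    linarith
  induction n with
  | zero => intro h _; simp [value_zero, stateLoss]
  | succ n ih =>
    intro h hf
    by_cases hw : weight P X h = 0
    · rw [value_of_weight_eq_zero hw, hw, zero_mul]
    -- A round of waiting earns at most `max xm 0`, a shortfall of at least `L` in the normalized
    -- units, while one round more raises the loss by at most `L`.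
    have hinc : stateLoss (mean P X) c L (failProb P X xp) (n + 1) (unexplored h) -
        stateLoss (mean P X) c L (failProb P X xp) n (unexplored h) ≤ L := by
      rw [stateLoss, stateLoss, below_eq_empty hμ]
      exact loss_single_succ_sub_le hr0 hr1 hL0 n fun i _ => hrL i
    have hinc' := mul_le_mul_of_nonneg_left hinc hd.le
    rw [hL] at hinc'
    have hm := le_max_left xm 0
    have hm0 := le_max_right xm 0
    refine H.value_succ_le hxp hw hf (hsafe h)
      (z := fun i => stateLoss (mean P X) c L (failProb P X xp) n ((unexplored h).erase i))
      (v := n * xp - (xp - xm) *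
        stateLoss (mean P X) c L (failProb P X xp) n (unexplored h)) (ν := 0) ?_ ?_ le_rfl
      (Or.inl rfl) ?_ ?_ ?_
    · intro i hi
      have := ih (h ++ [(some i, xm)]) (by simpa [H.lt.ne'] using hf)
      rwa [unexplored_append_some] at this
    · intro h' _ hs hf'
      have := ih h' hf'
      rwa [hs] at this
    · intro i hi
      have : stateLoss (mean P X) c L (failProb P X xp) (n + 1) (unexplored h) ≤
          failProb P X xp i * (1 + stateLoss (mean P X) c L (failProb P X xp) n
            ((unexplored h).erase i)) := by
        rw [stateLoss, stateLoss, below_eq_empty hμ, below_eq_empty hμ, above_erase]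
        exact loss_le_single n (mem_above.2 ⟨hi, hμ i⟩)
      have := mul_le_mul_of_nonneg_left this hd.le
      push_cast
      linarith
    · push_cast; linarith
    · push_cast; linarith

namespace Mixed

variable {c : ℝ}

lemma mean_eq_mul (H : Mixed P X xm xp c) (i : Fin K) :
    mean P X i = (xp - xm) * (c - failProb P X xp i) := by
  rw [H.mean_eq, mul_sub, H.mul_eq]

lemma separated (H : Mixed P X xm xp c) (s : Finset (Fin K)) :
    Separated c (failProb P X xp) (above (mean P X) s) (below (mean P X) s) := by
  have hd : 0 < xp - xm := sub_pos.2 H.lt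
  refine ⟨fun i hi => ?_, fun i hi => ?_⟩
  · have := (mem_above.1 hi).2
    rw [H.mean_eq_mul] at this
    linarith [(mul_pos_iff_of_pos_left hd).1 this]
  · have := (mem_below.1 hi).2
    rw [H.mean_eq_mul] at this
    by_contra! hle
    linarith [mul_nonneg hd.le (sub_nonneg.2 hle)]

/-- Without arms of positive mean, nothing can be gained. -/
lemma value_le_of_above_eq_empty (H : Mixed P X xm xp c) (hsafe : IsSafe P X alg) (n : ℕ) :
    ∀ h, (∀ i, (some i, xp) ∉ h) → above (mean P X) (unexplored h) = ∅ →
      value P X alg n h ≤ weight P X h * 0 := by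
  induction n with
  | zero => intro h _ _; simp [value_zero]
  | succ n ih =>
    intro h hf hs
    by_cases hw : weight P X h = 0
    · rw [value_of_weight_eq_zero hw, hw, zero_mul]
    have hneg : ∀ i ∈ unexplored h, mean P X i < 0 := by
      intro i hi
      refine lt_of_le_of_ne (not_lt.1 fun hpos => ?_) (H.ne i)
      have : i ∈ above (mean P X) (unexplored h) := mem_above.2 ⟨hi, hpos⟩
      simp [hs] at this
    have hterm : ∀ i ∈ unexplored h, 0 ≤ (n + 1) * xp / -mean P X i := fun i hi =>
      div_nonneg (by have := H.pos; positivity) (by linarith [hneg i hi])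
    -- The price is so high that even `xp` in all `n + 1` rounds would not pay for exploring any one
    -- of these arms.
    refine H.value_succ_le H.pos.le hw hf (hsafe h) (z := fun _ => 0) (v := 0)
      (ν := ∑ i ∈ unexplored h, (n + 1) * xp / -mean P X i) ?_ ?_
      (Finset.sum_nonneg hterm) (Or.inr H.neg.le) ?_ le_rfl (by linarith [H.neg])
    · intro i hi
      have := H.value_le H.pos.le alg n (h ++ [(some i, xm)])
      simpa using this
    · intro h' _ hs' hf'
      exact ih h' hf' (hs' ▸ hs)
    · intro i hi
      have h1 := Finset.single_le_sum hterm hi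
      have h2 : 0 < -mean P X i := by linarith [hneg i hi]
      rw [div_le_iff₀ h2] at h1
      have h3 : 0 ≤ (xp - xm) * (failProb P X xp i * (1 + 0)) :=
        mul_nonneg (sub_pos.2 H.lt).le (by linarith [H.fail_pos i])
      linarith

/-- From state `s`, no safe algorithm is better than exploring best pairs, up to an error that
vanishes for many rounds. -/
lemma exists_value_le (H : Mixed P X xm xp c) (s : Finset (Fin K)) :
    ∃ C, ∀ alg : Algorithm K, IsSafe P X alg → ∀ n h, unexplored h = s →
      (∀ i, (some i, xp) ∉ h) → value P X alg n h ≤ weight P X h *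
        (n * xp - (xp - xm) * stateLoss (mean P X) c c (failProb P X xp) n s +
          max 0 (C - (1 - c) * xp * n)) := by
  induction s using Finset.strongInduction with
  | H s ihs =>
  have hd : 0 < xp - xm := sub_pos.2 H.lt
  have hc0 := H.c_pos
  have hc1 := H.c_lt
  have hε : 0 < (1 - c) * xp := mul_pos (sub_pos.2 hc1) H.pos
  have hr0 : ∀ i, 0 ≤ failProb P X xp i := fun i => (H.fail_pos i).le
  have hsep := H.separated s
  rcases (above (mean P X) s).eq_empty_or_nonempty with he | hne
  · refine ⟨0, fun alg hsafe n h hs hf => ?_⟩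
    refine (H.value_le_of_above_eq_empty hsafe n h hf (hs ▸ he)).trans
      (mul_le_mul_of_nonneg_left ?_ weight_nonneg)
    rw [stateLoss, he, loss_empty, ← mul_assoc, H.mul_eq]
    have := le_max_left 0 (0 - (1 - c) * xp * n)
    linarith
  choose! C hC using fun i (hi : i ∈ s) => ihs (s.erase i) (Finset.erase_ssubset hi)
  obtain ⟨N₀, hN₀⟩ := exists_price H.fail_pos H.fail_lt hc0 hc1.le hsep hne
  obtain ⟨N₁, hN₁⟩ := exists_nat_ge ((∑ i ∈ s, |C i|) / ((1 - c) * xp))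
  -- From `N` rounds on the price exists (`N₀`) and the errors of all successor states have vanished
  -- (`N₁`); the bound `c * c` on the increment needs at least one round.
  set N := max (max N₀ N₁) 1 with hN
  -- For at most `N` rounds this leaves an error of at least `xp` per round, so the trivial bound
  -- `value_le` suffices there.
  refine ⟨(xp + (1 - c) * xp) * N, fun alg hsafe n => ?_⟩
  induction n with
  | zero => intro h _ _; rw [value_zero]; exact mul_nonneg weight_nonneg (by simp [stateLoss])
  | succ n ih =>
    intro h hs hf
    by_cases hw : weight P X h = 0
    · rw [value_of_weight_eq_zero hw, hw, zero_mul]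
    rcases lt_or_ge n N with hnN | hnN
    · refine (H.value_le H.pos.le alg (n + 1) h).trans
        (mul_le_mul_of_nonneg_left ?_ weight_nonneg)
      have h1 := mul_le_mul_of_nonneg_left (loss_le_mul hr0 hc0.le hc1.le (n + 1) hsep) hd.le
      rw [← mul_assoc, H.mul_eq] at h1
      have h2 : ((n + 1 : ℕ) : ℝ) ≤ N := by exact_mod_cast hnN
      have h3 := mul_le_mul_of_nonneg_left h2 H.pos.le
      have h4 := mul_le_mul_of_nonneg_left h2 hε.le
      have h5 := le_max_right 0 ((xp + (1 - c) * xp) * N - (1 - c) * xp * (n + 1 : ℕ))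
      rw [stateLoss]
      linarith
    obtain ⟨m, rfl⟩ : ∃ m, n = m + 1 := ⟨n - 1, by omega⟩
    obtain ⟨ν, hν, hνI, hνJ⟩ := hN₀ (m + 1) (by omega)
    have hinc := mul_le_mul_of_nonneg_left
      (loss_add_two_sub_le_sq hr0 hc0.le hc1.le m hsep hne) hd.le
    rw [← mul_assoc, H.mul_eq] at hinc
    have hCi : ∀ i ∈ s, C i ≤ (1 - c) * xp * (m + 1 : ℕ) := by
      intro i hi
      have h1 : N₁ ≤ m + 1 := by omega
      have h2 : (N₁ : ℝ) ≤ (m + 1 : ℕ) := by exact_mod_cast h1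
      have h3 := (div_le_iff₀ hε).1 (hN₁.trans h2)
      have h4 := Finset.single_le_sum (f := fun i => |C i|) (fun i _ => abs_nonneg _) hi
      have h5 := le_abs_self (C i)
      linarith
    set B := (xp + (1 - c) * xp) * N
    -- Waiting passes from `m + 2` to `m + 1` rounds and raises the error by at most `(1 - c) * xp`.
    -- This is covered by the round's ceiling `xp` less the growth of the scaled loss, at most `c *
    -- xp`.
    have hB : max 0 (B - (1 - c) * xp * (m + 1 : ℕ)) ≤
        max 0 (B - (1 - c) * xp * (m + 1 + 1 : ℕ)) + (1 - c) * xp := by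
      refine max_le (by positivity) ?_
      have := le_max_right 0 (B - (1 - c) * xp * (m + 1 + 1 : ℕ))
      push_cast at this ⊢
      linarith
    have hB0 := le_max_left 0 (B - (1 - c) * xp * (m + 1 + 1 : ℕ))
    refine H.value_succ_le H.pos.le hw hf (hsafe h)
      (z := fun i => stateLoss (mean P X) c c (failProb P X xp) (m + 1) (s.erase i))
      (v := (m + 1 : ℕ) * xp - (xp - xm) *
        stateLoss (mean P X) c c (failProb P X xp) (m + 1) s +
        max 0 (B - (1 - c) * xp * (m + 1 : ℕ))) (ν := ν) ?_ ?_ hν (Or.inr H.neg.le) ?_ ?_ ?_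
    · intro i hi
      rw [hs] at hi
      have := hC i hi alg hsafe (m + 1) (h ++ [(some i, xm)])
        (by rw [unexplored_append_some, hs]) (by simpa [H.lt.ne'] using hf)
      rwa [max_eq_left (sub_nonpos.2 (hCi i hi)), add_zero] at this
    · intro h' _ hs' hf'
      exact ih h' (hs'.trans hs) hf'
    · intro i hi
      rw [hs] at hi
      have key : stateLoss (mean P X) c c (failProb P X xp) (m + 1 + 1) s +
          ν * (c - failProb P X xp i) ≤ failProb P X xp i *
          (1 + stateLoss (mean P X) c c (failProb P X xp) (m + 1) (s.erase i)) := by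
        rcases lt_or_gt_of_ne (H.ne i) with hi' | hi'
        · rw [stateLoss, stateLoss, above_erase_of_neg hi', below_erase]
          exact hνJ i (mem_below.2 ⟨hi, hi'⟩)
        · rw [stateLoss, stateLoss, below_erase_of_pos hi', above_erase]
          exact hνI i (mem_above.2 ⟨hi, hi'⟩)
      have key' := mul_le_mul_of_nonneg_left key hd.le
      have e : ν * mean P X i = (xp - xm) * (ν * (c - failProb P X xp i)) := by
        rw [H.mean_eq_mul]; ring
      rw [e]
      push_cast at hB0 ⊢
      linarith
    · rw [stateLoss, stateLoss]
      push_cast at hB ⊢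
      linarith
    · have := H.neg
      rw [stateLoss, stateLoss]
      push_cast at hB ⊢
      linarith

end Mixed

end TwoValued

/-! ### Existence, safety and value of the algorithm. -/

section Portfolios

variable {K : ℕ} {μ : Fin K → ℝ} {i j : Fin K}

lemma sum_single_mul (a : Arm K) (f : Arm K → ℝ) : ∑ b, single a b * f b = f a := by
  simp [single]

lemma single_mem (a : Arm K) : single a ∈ stdSimplex ℝ (Arm K) := by
  refine ⟨fun b => ?_, by simp [single]⟩
  rw [single]
  split_ifs <;> norm_num

lemma sum_pair_mul (hij : i ≠ j) (f : Arm K → ℝ) : ∑ a, pair μ i j a * f a =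
    -μ j / (μ i - μ j) * f (some i) + μ i / (μ i - μ j) * f (some j) := by
  have e : ∀ a, pair μ i j a * f a =
      (if a = some i then -μ j / (μ i - μ j) * f (some i) else 0) +
      (if a = some j then μ i / (μ i - μ j) * f (some j) else 0) := by
    intro a
    rw [pair]
    by_cases h1 : a = some i
    · have h2 : a ≠ some j := by rw [h1]; simpa using hij
      simp [h1, hij]
    · by_cases h2 : a = some j
      · simp [h2, hij.symm]
      · simp [h1, h2]
  simp [e, Finset.sum_add_distrib]

lemma pair_mem (hi : 0 < μ i) (hj : μ j < 0) : pair μ i j ∈ stdSimplex ℝ (Arm K) := by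
  have hij : i ≠ j := by
    rintro rfl
    exact lt_asymm hi hj
  have hd : 0 < μ i - μ j := by linarith
  refine ⟨fun a => ?_, ?_⟩
  · rw [pair]
    split_ifs
    · exact div_nonneg (by linarith) hd.le
    · exact div_nonneg hi.le hd.le
    · exact le_rfl
  · have := sum_pair_mul (μ := μ) hij fun _ => 1
    simp only [mul_one] at this
    rw [this, ← add_div, div_eq_one_iff_eq hd.ne']
    ring

lemma exists_isOGPChoice {s : Finset (Fin K)} (hs : (above μ s).Nonempty) :
    ∃ p : Portfolio K, IsOGPChoice μ s p.1 := by
  obtain ⟨i, hi, hmax⟩ := (above μ s).exists_max_image μ hs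
  rcases (below μ s).eq_empty_or_nonempty with he | hne
  · exact ⟨⟨_, single_mem (some i)⟩, i, hi, hmax, Or.inl ⟨he, rfl⟩⟩
  · obtain ⟨j, hj, hjmax⟩ := (below μ s).exists_max_image μ hne
    exact ⟨⟨_, pair_mem (mem_above.1 hi).2 (mem_below.1 hj).2⟩, i, hi, hmax,
      Or.inr ⟨j, hj, hjmax, rfl⟩⟩

lemma exists_isExploit (h : History K) : ∃ p : Portfolio K, IsExploit h p.1 := by
  classical
  obtain ⟨e, he, hmax⟩ := (((none, 0) :: h : History K).toFinset).exists_max_image Prod.snd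
    ⟨(none, 0), by simp⟩
  exact ⟨⟨_, single_mem e.1⟩, e, List.mem_toFinset.1 he,
    fun e' he' => hmax e' (List.mem_toFinset.2 he'), rfl⟩

lemma exists_isSEGB' (hμ : ∀ i, μ i ≠ 0) (xp : ℝ) : ∃ alg : Algorithm K, IsSEGB' μ xp alg := by
  have hall : ∀ h : History K, ∃ p : Portfolio K,
      ((∀ i, (some i, xp) ∉ h) → ¬ IsTerminal μ (unexplored h) →
        IsOGPChoice μ (unexplored h) p.1) ∧
      ((∃ i, (some i, xp) ∈ h) ∨ IsTerminal μ (unexplored h) → IsExploit h p.1) := by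
    intro h
    by_cases hx : (∃ i, (some i, xp) ∈ h) ∨ IsTerminal μ (unexplored h)
    · obtain ⟨p, hp⟩ := exists_isExploit h
      refine ⟨p, fun h1 h2 => ?_, fun _ => hp⟩
      rcases hx with ⟨i, hi⟩ | ht
      · exact absurd hi (h1 i)
      · exact absurd ht h2
    · have hne : (above μ (unexplored h)).Nonempty := by
        rw [Finset.nonempty_iff_ne_empty]
        exact fun he => hx (Or.inr ((isTerminal_iff hμ).2 he))
      obtain ⟨p, hp⟩ := exists_isOGPChoice hne
      exact ⟨p, fun _ _ => hp, fun h' => absurd h' hx⟩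
  choose alg halg using hall
  exact ⟨alg, fun h => (halg h).1, fun h => (halg h).2⟩

end Portfolios

/-- The arm exploited has the observed reward with certainty. -/
lemma IsExploit.mem {p : Arm K → ℝ} (hw : weight P X h ≠ 0) (hp : IsExploit h p) :
    ∃ a v, ((a = none ∧ v = 0) ∨ (∃ i, a = some i) ∧ (a, v) ∈ h) ∧
      (∀ e ∈ ((none, 0) :: h : History K), e.2 ≤ v) ∧ p = single a := by
  obtain ⟨⟨a, v⟩, he, hmax, rfl⟩ := hp
  refine ⟨a, v, ?_, hmax, rfl⟩
  rcases List.mem_cons.1 he with he | he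
  · simp only [Prod.mk.injEq] at he
    exact Or.inl he
  · cases a with
    | none => exact Or.inl ⟨rfl, eq_zero_of_none_mem hw he⟩
    | some i => exact Or.inr ⟨⟨i, rfl⟩, he⟩

namespace TwoValued

variable [IsProbabilityMeasure P]

lemma isSafe (H : TwoValued P X xm xp)
    (halg : IsSEGB' (mean P X) xp alg) : IsSafe P X alg := by
  intro h
  -- Safety is required even after null histories; there conditioning gives the zero measure and the
  -- constraint reads `0 ≤ 0`.
  by_cases hw : weight P X h = 0
  · have hc : P[|agree X h] = 0 := by
      rw [ProbabilityTheory.cond, Measure.restrict_eq_zero.2 ((measureReal_eq_zero_iff).1 hw),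
        smul_zero]
    simp [IsSafePortfolio, posteriorMean, hc]
  have hun : ∀ i ∈ unexplored h, posteriorMean P X h (some i) = mean P X i := fun i hi =>
    mul_left_cancel₀ hw (H.weight_mul_posteriorMean_of_unexplored hi)
  set f : Arm K → ℝ := fun a => a.elim 0 fun i => posteriorMean P X h (some i) with hf
  have hsum : ∑ i, (alg h).1 (some i) * posteriorMean P X h (some i) =
      ∑ a, (alg h).1 a * f a := by
    rw [Fintype.sum_option]
    simp [hf]
  rw [IsSafePortfolio, hsum]
  by_cases hx : (∃ i, (some i, xp) ∈ h) ∨ IsTerminal (mean P X) (unexplored h)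
  · obtain ⟨a, v, hav, hmax, hp⟩ := (halg.exploit h hx).mem hw
    rw [hp, sum_single_mul]
    rcases hav with ⟨rfl, -⟩ | ⟨⟨i, rfl⟩, hmem⟩
    · simp [hf]
    · have : f (some i) = v :=
        mul_left_cancel₀ hw (weight_mul_posteriorMean_of_mem H.meas hmem)
      rw [this]
      exact hmax (none, 0) (by simp)
  · obtain ⟨i, hi, -, hch⟩ := halg.explore h (fun i hi => hx (Or.inl ⟨i, hi⟩))
      fun ht => hx (Or.inr ht)
    have hi' := mem_above.1 hi
    rcases hch with ⟨-, hp⟩ | ⟨j, hj, -, hp⟩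
    · rw [hp, sum_single_mul]
      exact hi'.2.le.trans_eq (hun i hi'.1).symm
    · have hj' := mem_below.1 hj
      have hij : i ≠ j := by
        rintro rfl
        exact lt_asymm hi'.2 hj'.2
      rw [hp, sum_pair_mul hij]
      have e1 : f (some i) = mean P X i := hun i hi'.1
      have e2 : f (some j) = mean P X j := hun j hj'.1
      rw [e1, e2]
      refine le_of_eq ?_
      ring

/-- Once the reward `xp` is found, `SEGB'` earns it in every round. -/
lemma le_value_of_found (H : TwoValued P X xm xp) (hxp : 0 < xp)
    (halg : IsSEGB' (mean P X) xp alg) (n : ℕ) : ∀ h, (∃ i, (some i, xp) ∈ h) →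
    weight P X h * (n * xp) ≤ value P X alg n h := by
  induction n with
  | zero => intro h _; simp [value_zero]
  | succ n ih =>
    intro h hx
    by_cases hw : weight P X h = 0
    · rw [value_of_weight_eq_zero hw, hw, zero_mul]
    obtain ⟨a, v, hav, hmax, hp⟩ := (halg.exploit h (Or.inl hx)).mem hw
    obtain ⟨k, hk⟩ := hx
    have hv : xp ≤ v := hmax (some k, xp) (by simp [hk])
    rw [H.value_succ, hp, sum_single_mul]
    rcases hav with ⟨-, rfl⟩ | ⟨⟨i, rfl⟩, hmem⟩
    · exact absurd hxp hv.not_gt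
    · obtain rfl : v = xp := by
        rcases H.eq_or_eq_of_mem hw hmem with rfl | e
        · exact absurd H.lt hv.not_gt
        · exact e
      have := ih (h ++ [(some i, v)]) ⟨i, by simp⟩
      rw [weight_append_of_mem hmem] at this
      rw [armValue, weight_append_of_mem hmem, weight_append_of_mem_ne hmem H.lt.ne,
        value_append_of_mem_ne hmem H.lt.ne]
      push_cast
      linarith

/-- The value of `SEGB'`, for any loss that satisfies the recursion along its choices. -/
lemma le_value (H : TwoValued P X xm xp) (hxp : 0 < xp) (hμ : ∀ i, mean P X i ≠ 0)
    (hne : (above (mean P X) Finset.univ).Nonempty) (halg : IsSEGB' (mean P X) xp alg)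
    {Z : ℕ → Finset (Fin K) → ℝ} (hZ0 : ∀ s, Z 0 s = 0)
    (hterm : ∀ n s, above (mean P X) s = ∅ → (xp - xm) * Z n s = (xp - max xm 0) * n)
    (hsingle : ∀ n s i, i ∈ above (mean P X) s → (∀ k ∈ above (mean P X) s,
      mean P X k ≤ mean P X i) → below (mean P X) s = ∅ →
      Z (n + 1) s = failProb P X xp i * (1 + Z n (s.erase i)))
    (hpair : ∀ n s i j, i ∈ above (mean P X) s → (∀ k ∈ above (mean P X) s,
      mean P X k ≤ mean P X i) → j ∈ below (mean P X) s → (∀ k ∈ below (mean P X) s,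
      mean P X k ≤ mean P X j) → (mean P X i - mean P X j) * Z (n + 1) s =
        -mean P X j * (failProb P X xp i * (1 + Z n (s.erase i))) +
        mean P X i * (failProb P X xp j * (1 + Z n (s.erase j))))
    (n : ℕ) : ∀ h, (∀ i, (some i, xp) ∉ h) →
    weight P X h * (n * xp - (xp - xm) * Z n (unexplored h)) ≤ value P X alg n h := by
  induction n with
  | zero => intro h _; simp [value_zero, hZ0]
  | succ n ih =>
    intro h hf
    by_cases hw : weight P X h = 0
    · rw [value_of_weight_eq_zero hw, hw, zero_mul]
    have hw0 : 0 ≤ weight P X h := weight_nonneg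
    rw [H.value_succ]
    by_cases ht : IsTerminal (mean P X) (unexplored h)
    · obtain ⟨a, v, hav, hmax, hp⟩ := (halg.exploit h (Or.inr ht)).mem hw
      rw [hp, sum_single_mul]
      have hab := (isTerminal_iff hμ).1 ht
      have hv0 : 0 ≤ v := hmax (none, 0) (by simp)
      -- An arm of positive mean existed initially and is explored in a terminal state, so `xm` is
      -- among the rewards to exploit, next to `0`.
      have hvm : max xm 0 ≤ v := by
        refine max_le ?_ hv0
        obtain ⟨k, hk⟩ := hne
        have hk' : k ∉ unexplored h := by
          intro hk'
          have : k ∈ above (mean P X) (unexplored h) := mem_above.2 ⟨hk', (mem_above.1 hk).2⟩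
          simp [hab] at this
        exact hmax (some k, xm) (by simp [H.mem_of_notMem_unexplored hw hf hk'])
      have e1 := hterm n _ hab
      have e2 := hterm (n + 1) _ hab
      rw [e2]
      rcases hav with ⟨rfl, rfl⟩ | ⟨⟨i, rfl⟩, hmem⟩
      · have h1 := ih (h ++ [(none, 0)]) (by simpa using hf)
        rw [unexplored_append_none, weight_append_none, e1] at h1
        rw [armValue]
        have := mul_le_mul_of_nonneg_left hvm hw0
        push_cast
        linarith
      · obtain rfl : v = xm := by
          rcases H.eq_or_eq_of_mem hw hmem with e | rfl
          · exact e
          · exact absurd hmem (hf i)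
        have hi : i ∉ unexplored h := fun hi => mem_unexplored.1 hi v hmem
        have h1 := ih (h ++ [(some i, v)]) (by simpa [H.lt.ne'] using hf)
        rw [unexplored_append_of_notMem hi, weight_append_of_mem hmem, e1] at h1
        rw [armValue, weight_append_of_mem hmem, weight_append_of_mem_ne hmem H.lt.ne',
          value_append_of_mem_ne hmem H.lt.ne']
        have := mul_le_mul_of_nonneg_left hvm hw0
        push_cast
        linarith
    · have harm : ∀ i ∈ unexplored h, weight P X h * ((n + 1) * xp - (xp - xm) *
          (failProb P X xp i * (1 + Z n ((unexplored h).erase i)))) ≤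
          armValue P X xm xp alg n h (some i) := by
        intro i hi
        have h1 := H.le_value_of_found hxp halg n (h ++ [(some i, xp)]) ⟨i, by simp⟩
        have h2 := ih (h ++ [(some i, xm)]) (by simpa [H.lt.ne'] using hf)
        rw [H.weight_append_xp hi] at h1
        rw [unexplored_append_some, H.weight_append_xm hi] at h2
        rw [armValue, H.weight_append_xm hi, H.weight_append_xp hi]
        linarith
      obtain ⟨i, hi, hmax, hch⟩ := halg.explore h hf ht
      have hi' := mem_above.1 hi
      rcases hch with ⟨he, hp⟩ | ⟨j, hj, hjmax, hp⟩
      · rw [hp, sum_single_mul, hsingle n _ i hi hmax he]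
        push_cast
        exact harm i hi'.1
      · have hj' := mem_below.1 hj
        have hij : i ≠ j := by
          rintro rfl
          exact lt_asymm hi'.2 hj'.2
        have hd : 0 < mean P X i - mean P X j := by linarith [hi'.2, hj'.2]
        rw [hp, sum_pair_mul hij, div_mul_eq_mul_div, div_mul_eq_mul_div, ← add_div,
          le_div_iff₀ hd]
        have h1 := mul_le_mul_of_nonneg_left (harm i hi'.1) (by linarith [hj'.2] :
          0 ≤ -mean P X j)
        have h2 := mul_le_mul_of_nonneg_left (harm j hj'.1) hi'.2.le
        refine le_trans (le_of_eq ?_) (add_le_add h1 h2)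
        push_cast
        linear_combination (-(weight P X h * (xp - xm))) * hpair n _ i j hi hmax hj hjmax

/-- If all means are negative, safe algorithms never leave the safe arm. -/
lemma value_eq_zero_of_neg (H : TwoValued P X xm xp) (hμ : ∀ i, mean P X i < 0)
    (hsafe : IsSafe P X alg) (n : ℕ) : ∀ h, unexplored h = Finset.univ →
    value P X alg n h = 0 := by
  induction n with
  | zero => intro h _; exact value_zero
  | succ n ih =>
    intro h hs
    by_cases hw : weight P X h = 0
    · exact value_of_weight_eq_zero hw
    have hterm : ∀ i ∈ Finset.univ, (alg h).1 (some i) * posteriorMean P X h (some i) ≤ 0 := by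
      intro i _
      rw [mul_left_cancel₀ hw (H.weight_mul_posteriorMean_of_unexplored (hs ▸ Finset.mem_univ i))]
      exact mul_nonpos_of_nonneg_of_nonpos ((alg h).2.1 _) (hμ i).le
    have h0 : ∀ i, (alg h).1 (some i) = 0 := by
      intro i
      have := (Finset.sum_eq_zero_iff_of_nonpos hterm).1
        (le_antisymm (Finset.sum_nonpos hterm) (hsafe h)) i (Finset.mem_univ i)
      rw [mul_left_cancel₀ hw
        (H.weight_mul_posteriorMean_of_unexplored (hs ▸ Finset.mem_univ i))] at this
      exact (mul_eq_zero.1 this).resolve_right (hμ i).ne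
    rw [H.value_succ, Fintype.sum_option]
    simp only [h0, zero_mul, Finset.sum_const_zero, add_zero, armValue]
    rw [ih _ (by rw [unexplored_append_none, hs]), mul_zero]

/-! ### Optimality in the three sign cases, and the degenerate case. -/

/-- The optimality of `SEGB'` if there are two different possible rewards. -/
lemma exists_forall_utility_eq_opt (H : TwoValued P X xm xp) (hμ : ∀ i, mean P X i ≠ 0)
    (hnondeg : (∃ i, 0 < mean P X i) → (∃ j, mean P X j < 0) →
      ∀ i, 0 < P.real {ω | X i ω = xp} ∧ P.real {ω | X i ω = xp} < 1) :
    ∃ T₀ : ℕ, ∀ T ≥ T₀, ∀ alg : Algorithm K, IsSEGB' (mean P X) xp alg →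
      IsSafe P X alg ∧ BddAbove (safeUtilities P X T) ∧ utility P X T alg = opt P X T := by
  have hw1 : weight P X [] = 1 := by simp [weight, agree]
  have hun : unexplored ([] : History K) = Finset.univ := by ext; simp [unexplored]
  suffices hsuff : ∃ T₀ : ℕ, ∀ T ≥ T₀, ∀ alg : Algorithm K, IsSEGB' (mean P X) xp alg →
      ∀ alg' : Algorithm K, IsSafe P X alg' → value P X alg' T [] ≤ value P X alg T [] by
    obtain ⟨T₀, hT₀⟩ := hsuff
    refine ⟨T₀, fun T hT alg halg => ?_⟩
    have hs := H.isSafe halg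
    have hg : IsGreatest (safeUtilities P X T) (utility P X T alg) := by
      refine ⟨⟨alg, hs, rfl⟩, ?_⟩
      rintro _ ⟨alg', hs', rfl⟩
      rw [utility_eq_value, utility_eq_value]
      exact hT₀ T hT alg halg alg' hs'
    exact ⟨hs, hg.bddAbove, hg.csSup_eq.symm⟩
  have hd : 0 < xp - xm := sub_pos.2 H.lt
  by_cases hpos : ∃ i, 0 < mean P X i
  swap
  · have hneg : ∀ i, mean P X i < 0 := fun i =>
      lt_of_le_of_ne (not_lt.1 fun h => hpos ⟨i, h⟩) (hμ i)
    refine ⟨0, fun T _ alg halg alg' hs' => ?_⟩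
    rw [H.value_eq_zero_of_neg hneg hs' T _ hun,
      H.value_eq_zero_of_neg hneg (H.isSafe halg) T _ hun]
  obtain ⟨i₀, hi₀⟩ := hpos
  have hne : (above (mean P X) Finset.univ).Nonempty :=
    ⟨i₀, mem_above.2 ⟨Finset.mem_univ _, hi₀⟩⟩
  have hr0 : ∀ i, 0 ≤ failProb P X xp i := fun i => failProb_nonneg
  have hxp : 0 < xp := by
    have := H.mean_eq i₀
    nlinarith [hr0 i₀]
  have hmono : ∀ {k l}, mean P X k ≤ mean P X l → failProb P X xp l ≤ failProb P X xp k := by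
    intro k l hkl
    rw [H.mean_eq, H.mean_eq] at hkl
    exact le_of_mul_le_mul_left (by linarith) hd
  by_cases hneg : ∃ j, mean P X j < 0
  · obtain ⟨j₀, hj₀⟩ := hneg
    have hq := hnondeg ⟨i₀, hi₀⟩ ⟨j₀, hj₀⟩
    set c := xp / (xp - xm) with hc
    have hxm : xm < 0 := by
      have h1 := H.mean_eq j₀
      have h2 := failProb_le_one (P := P) (X := X) (xp := xp) (i := j₀)
      nlinarith
    have M : Mixed P X xm xp c :=
      { toTwoValued := H
        neg := hxm
        pos := hxp
        mul_eq := mul_div_cancel₀ _ hd.ne'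
        ne := hμ
        fail_pos := fun i => sub_pos.2 (hq i).2
        fail_lt := fun i => sub_lt_self _ (hq i).1 }
    have hc0 := M.c_pos
    have hc1 := M.c_lt
    obtain ⟨C, hC⟩ := M.exists_value_le Finset.univ
    obtain ⟨T₀, hT₀⟩ := exists_nat_ge (C / ((1 - c) * xp))
    refine ⟨T₀, fun T hT alg halg alg' hs' => ?_⟩
    have hup := hC alg' hs' T [] hun (by simp)
    have hCT : C - (1 - c) * xp * T ≤ 0 := by
      have h1 : (T₀ : ℝ) ≤ T := by exact_mod_cast hT
      have := (div_le_iff₀ (mul_pos (sub_pos.2 hc1) hxp)).1 (hT₀.trans h1)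
      linarith
    rw [max_eq_left hCT, add_zero, ← hun] at hup
    refine hup.trans (H.le_value hxp hμ hne halg (fun s => rfl) ?_ ?_ ?_ T [] (by simp))
    · intro n s hs
      rw [stateLoss, hs, loss_empty, ← mul_assoc, M.mul_eq, max_eq_right hxm.le, sub_zero]
    · intro n s i hi hmax he
      rw [stateLoss, stateLoss, below_erase, above_erase, he, Finset.erase_empty]
      exact loss_eq_single hr0 n hi fun k hk => hmono (hmax k hk)
    · intro n s i j hi hmax hj hjmax
      have hsep := M.separated s
      have e := loss_eq_chord hr0 hc0.le hc1.le n hsep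
        ⟨hi, hj, fun k hk => hmono (hmax k hk), fun k hk => hmono (hjmax k hk)⟩
      have e1 := chord_spec (c := c) ((hsep.left i hi).trans (hsep.right j hj))
        (loss c c (failProb P X xp) n ((above (mean P X) s).erase i) (below (mean P X) s))
        (loss c c (failProb P X xp) n (above (mean P X) s) ((below (mean P X) s).erase j))
      rw [← e] at e1
      rw [stateLoss, stateLoss, stateLoss, above_erase_of_neg (mem_below.1 hj).2, above_erase,
        below_erase_of_pos (mem_above.1 hi).2, below_erase, M.mean_eq_mul, M.mean_eq_mul]
      linear_combination (xp - xm) * e1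
  · have hall : ∀ i, 0 < mean P X i := fun i =>
      lt_of_le_of_ne (not_lt.1 fun h => hneg ⟨i, h⟩) (hμ i).symm
    have hL : (xp - xm) * ((xp - max xm 0) / (xp - xm)) = xp - max xm 0 :=
      mul_div_cancel₀ _ hd.ne'
    refine ⟨0, fun T _ alg halg alg' hs' => ?_⟩
    -- The value of `c` is immaterial: without arms of negative mean no chord enters the loss.
    refine (H.value_le_of_pos hxp.le hall (c := 0) hL hs' T [] (by simp)).trans
      (H.le_value hxp hμ hne halg (fun s => rfl) ?_ ?_ ?_ T [] (by simp))
    · intro n s hs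
      rw [stateLoss, hs, loss_empty, ← mul_assoc, hL]
    · intro n s i hi hmax he
      rw [stateLoss, stateLoss, below_erase, above_erase, he, Finset.erase_empty]
      exact loss_eq_single hr0 n hi fun k hk => hmono (hmax k hk)
    · intro n s i j _ _ hj
      simp [below_eq_empty hall] at hj

end TwoValued

end SafeBandit

end

theorem mainTheorem6 {Ω : Type*} [MeasurableSpace Ω] (P : Measure Ω) [IsProbabilityMeasure P]
    {K : ℕ} (X : Fin K → Ω → ℝ) (hX : ∀ i, Measurable (X i)) (hindep : iIndepFun X P)
    (hmean : ∀ i, SafeBandit.mean P X i ≠ 0)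
    (xm xp : ℝ) (hle : xm ≤ xp)
    (htwo : ∀ i, ∀ᵐ ω ∂P, X i ω = xm ∨ X i ω = xp)
    (hnondeg : (∃ i, 0 < SafeBandit.mean P X i) → (∃ j, SafeBandit.mean P X j < 0) →
      ∀ i, 0 < P.real {ω | X i ω = xp} ∧ P.real {ω | X i ω = xp} < 1) :
    (∃ alg : SafeBandit.Algorithm K, SafeBandit.IsSEGB' (SafeBandit.mean P X) xp alg) ∧
    ∃ T₀ : ℕ, ∀ T ≥ T₀, ∀ alg : SafeBandit.Algorithm K,
      SafeBandit.IsSEGB' (SafeBandit.mean P X) xp alg →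
        SafeBandit.IsSafe P X alg ∧
        BddAbove (SafeBandit.safeUtilities P X T) ∧
        SafeBandit.utility P X T alg = SafeBandit.opt P X T := by
  refine ⟨SafeBandit.exists_isSEGB' hmean xp, ?_⟩
  rcases hle.lt_or_eq with hlt | rfl
  · exact SafeBandit.TwoValued.exists_forall_utility_eq_opt ⟨hX, hindep, hlt, htwo⟩ hmean hnondeg
  -- For constant rewards a fictitious lower value `xm - 1` restores the strict inequality and
  -- leaves the high reward unchanged.
  · have htwo' : ∀ i, ∀ᵐ ω ∂P, X i ω = xm - 1 ∨ X i ω = xm := fun i => by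
      filter_upwards [htwo i] with ω hω
      exact Or.inr (hω.elim id id)
    exact SafeBandit.TwoValued.exists_forall_utility_eq_opt
      ⟨hX, hindep, sub_one_lt xm, htwo'⟩ hmean hnondeg
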